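/- Fix integers $e\ge 2$ and $m$, and a residue $i\in\mathbb Z/e\mathbb Z$. **Partitions.** A partition $\lambda=(\lambda_0\ge\lambda_1\ge\cdots)$ is identified with its Young diagram. The node in row $a$ and column $b$ has residue $m-a+b \bmod e$. A node $x\notin\lambda$ of residue $i$ such that $\lambda\cup\{x\}$ is a Young diagram is an addable $i$-node of $\lambda$; a node $x\in\lambda$ of residue $i$ such that $\lambda\setminus\{x\}$ is a Young diagram is a removable $i$-node of $\lambda$. The crystal $B(\Lambda_m)$ of type $A^{(1)}_{e-1}$ is realized on the set of $e$-restricted partitions, i.e. those with $\lambda_k-\lambda_{k+1}<e$ for all $k\ge 0$. **Operators.** Read the addable ($A$) and removable ($R$) $i$-nodes of $\lambda$ from the first row to the last row as a word in $A$ and $R$, and delete adjacent pairs $RA$ as long as possible; a word of the form $A\cdots AR\cdots R$ remains. Then $\tilde f_i\lambda$ is obtained by adding the node of the rightmost remaining $A$ (and $\tilde f_i\lambda=0$ if there is none), and $\tilde e_i\lambda$ by removing the node of the leftmost remaining $R$ (and $\tilde e_i\lambda=0$ if there is none); also $\tilde f_i0=\tilde e_i0=0$. Put $\varphi_i(\lambda)=\max\{k\ge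 0\mid \tilde f_i^k\lambda\ne 0\}$ and $\tilde f_i^{\max}\lambda=\tilde f_i^{\varphi_i(\lambda)}\lambda$. **Reflections.** Let $wt(\lambda)=\Lambda_m-\sum_j N_j(\lambda)\alpha_j$, where $N_j(\lambda)$ is the number of nodes of residue $j$ in $\lambda$, and let $n=wt(\lambda)(h_i)$. Then $s_i\lambda=\tilde f_i^{\,n}\lambda$ if $n\ge 0$ and $s_i\lambda=\tilde e_i^{\,-n}\lambda$ if $n\le 0$. **Base.** Let $J=\{\lambda_k+m-k\mid k\ge 0\}$ be the set of beta numbers of charge $m$ of $\lambda$, and $U(J)=\{x\in J\mid x-e\notin J\}$. If $U(J)=\emptyset$, let $\operatorname{down}(\lambda)=\lambda$. Otherwise let $p'=\min U(J)$ and $q'=\min\big(\{x>p'-e\mid x\in J,\ x+e\notin J\}\cup\{p'\}\big)$, and let $\operatorname{down}(\lambda)$ be the partition whose set of beta numbers of charge $m$ is $(J\setminus\{q'\})\cup\{p'-e\}$. Applying $\operatorname{down}$ repeatedly, one reaches $U(J)=\emptyset$ after finitely many steps; the resulting partition is $\operatorname{base}(\lambda)$. **Theorem.** Let $\lambda\in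 B(\Lambda_m)$. Then $$\operatorname{base}(\tilde f_i^{\max}\lambda)=\begin{cases} s_i\operatorname{base}(\lambda) & \text{if } \operatorname{base}(\lambda) \text{ has an addable } i\text{-node},\\ \operatorname{base}(\lambda) & \text{otherwise,}\end{cases}$$ and $\operatorname{base}(\tilde f_i^{\,t}\lambda)=\operatorname{base}(\lambda)$ for all integers $0\le t<\varphi_i(\lambda)$. -/

import Mathlib

namespace KashiwaraBase

/-! ### Nodes, residues, addable and removable nodes

A partition is a `YoungDiagram`; rows and columns are numbered from `0`,
and `lam.rowLen k` is the part `lam_k`. -/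

/-- `e`-restricted partitions; these form the crystal `B(Λ_m)`. -/
def IsRestricted (e : ℕ) (lam : YoungDiagram) : Prop :=
  ∀ k : ℕ, lam.rowLen k < lam.rowLen (k + 1) + e

/-- The residue `m - a + b mod e` of the node in row `a` and column `b`. -/
def residue (e : ℕ) (m : ℤ) (x : ℕ × ℕ) : ZMod e :=
  ((m - (x.1 : ℤ) + (x.2 : ℤ) : ℤ) : ZMod e)

/-- `x` is an addable `i`-node of `lam`. -/
def IsAddable (e : ℕ) (m : ℤ) (i : ZMod e) (lam : YoungDiagram) (x : ℕ × ℕ) : Prop :=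
  x ∉ lam.cells ∧ IsLowerSet ((insert x lam.cells : Finset (ℕ × ℕ)) : Set (ℕ × ℕ)) ∧
    residue e m x = i

/-- `x` is a removable `i`-node of `lam`. -/
def IsRemovable (e : ℕ) (m : ℤ) (i : ZMod e) (lam : YoungDiagram) (x : ℕ × ℕ) : Prop :=
  x ∈ lam.cells ∧ IsLowerSet ((lam.cells.erase x : Finset (ℕ × ℕ)) : Set (ℕ × ℕ)) ∧
    residue e m x = i

open Classical in
/-- Add the node `x` (used when `x` is addable). -/
noncomputable def addNode (lam : YoungDiagram) (x : ℕ × ℕ) : YoungDiagram :=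
  if h : IsLowerSet ((insert x lam.cells : Finset (ℕ × ℕ)) : Set (ℕ × ℕ)) then
    ⟨insert x lam.cells, h⟩ else lam

open Classical in
/-- Remove the node `x` (used when `x` is removable). -/
noncomputable def removeNode (lam : YoungDiagram) (x : ℕ × ℕ) : YoungDiagram :=
  if h : IsLowerSet ((lam.cells.erase x : Finset (ℕ × ℕ)) : Set (ℕ × ℕ)) then
    ⟨lam.cells.erase x, h⟩ else lam

/-! ### `RA`-deletion and the Kashiwara operators -/

/-- A letter `A` or `R`, together with the node that it records. -/
inductive Letter : Type
  | A (x : ℕ × ℕ) : Letter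
  | R (x : ℕ × ℕ) : Letter

/-- One `RA`-deletion: an `R` and an `A` that are adjacent
(apart from letters deleted before) are deleted. -/
inductive RAStep : List Letter → List Letter → Prop
  | del (u v : List Letter) (x y : ℕ × ℕ) : RAStep (u ++ Letter.R x :: Letter.A y :: v) (u ++ v)

/-- The final sequence of the `RA`-deletion (see `raReduce_reaches`, `raReduce_final`). -/
def raReduce : List Letter → List Letter
  | [] => []
  | Letter.A x :: w => Letter.A x :: raReduce w
  | Letter.R x :: w =>
    match raReduce w with
    | Letter.A _ :: v => v
    | v => Letter.R x :: v

theorem RAStep.cons {u v : List Letter} (a : Letter) (h : RAStep u v) :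
    RAStep (a :: u) (a :: v) := by
  cases h with
  | del p q x y => exact RAStep.del (a :: p) q x y

theorem raReduce_reaches (w : List Letter) :
    Relation.ReflTransGen RAStep w (raReduce w) := by
  induction w with
  | nil => exact Relation.ReflTransGen.refl
  | cons a w ih =>
    have h1 : Relation.ReflTransGen RAStep (a :: w) (a :: raReduce w) := by
      generalize raReduce w = z at ih
      induction ih with
      | refl => exact Relation.ReflTransGen.refl
      | tail _ h2 ih2 => exact ih2.tail (h2.cons a)
    cases a with
    | A x => exact h1
    | R x =>
      rw [raReduce]
      split
      · rename_i y v hv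
        rw [hv] at h1
        exact h1.tail (RAStep.del [] v x y)
      · exact h1

theorem raReduce_shape (w : List Letter) : ∃ p q : List (ℕ × ℕ),
    raReduce w = p.map Letter.A ++ q.map Letter.R := by
  induction w with
  | nil => exact ⟨[], [], rfl⟩
  | cons a w ih =>
    obtain ⟨p, q, h⟩ := ih
    cases a with
    | A x => exact ⟨x :: p, q, by simp [raReduce, h]⟩
    | R x =>
      cases p with
      | cons y p => exact ⟨p, q, by simp [raReduce, h]⟩
      | nil =>
        refine ⟨[], x :: q, ?_⟩
        cases q <;> simp [raReduce, h]

theorem raReduce_final (w v : List Letter) : ¬ RAStep (raReduce w) v := by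
  obtain ⟨p, q, h⟩ := raReduce_shape w
  rw [h]
  have key : ∀ (r : List (ℕ × ℕ)) (s t : List Letter) (x y : ℕ × ℕ),
      r.map Letter.A ++ q.map Letter.R ≠ s ++ Letter.R x :: Letter.A y :: t := by
    intro r
    induction r with
    | nil =>
      intro s t x y hh
      have hmem : Letter.A y ∈ q.map Letter.R := by
        have h2 : q.map Letter.R = s ++ Letter.R x :: Letter.A y :: t := by simpa using hh
        rw [h2]
        simp
      simp at hmem
    | cons c r ihr =>
      intro s t x y hh
      cases s with
      | nil => simp at hh
      | cons d s =>
        simp only [List.map_cons, List.cons_append, List.cons.injEq] at hh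
        exact ihr s t x y hh.2
  generalize hu : p.map Letter.A ++ q.map Letter.R = u
  intro hs
  cases hs with
  | del s t x y => exact key p s t x y hu

open Classical in
/-- The letter recorded in row `k`, if there is one: an addable node of row `k` can only sit
in column `lam_k`, and a removable node only in column `lam_k - 1`. -/
noncomputable def rowLetters (e : ℕ) (m : ℤ) (i : ZMod e) (lam : YoungDiagram) (k : ℕ) :
    List Letter :=
  (if IsRemovable e m i lam (k, lam.rowLen k - 1) then [Letter.R (k, lam.rowLen k - 1)] else []) ++
    (if IsAddable e m i lam (k, lam.rowLen k) then [Letter.A (k, lam.rowLen k)] else [])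

/-- The addable and removable `i`-nodes of `lam`, read from the first row to the last row
(the empty row just below `lam` may hold an addable node). -/
noncomputable def word (e : ℕ) (m : ℤ) (i : ZMod e) (lam : YoungDiagram) : List Letter :=
  (List.range (lam.colLen 0 + 1)).flatMap (rowLetters e m i lam)

/-- The addable normal `i`-nodes, from the first row to the last row. -/
noncomputable def normalAddable (e : ℕ) (m : ℤ) (i : ZMod e) (lam : YoungDiagram) :
    List (ℕ × ℕ) :=
  (raReduce (word e m i lam)).filterMap fun
    | Letter.A x => some x
    | Letter.R _ => none

/-- The removable normal `i`-nodes, from the first row to the last row. -/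
noncomputable def normalRemovable (e : ℕ) (m : ℤ) (i : ZMod e) (lam : YoungDiagram) :
    List (ℕ × ℕ) :=
  (raReduce (word e m i lam)).filterMap fun
    | Letter.A _ => none
    | Letter.R x => some x

/-- The operator `f̃_i`; the value `none` is the extra element `0`. -/
noncomputable def fOp (e : ℕ) (m : ℤ) (i : ZMod e) (lam : YoungDiagram) : Option YoungDiagram :=
  (normalAddable e m i lam).getLast?.map (addNode lam)

/-- The operator `ẽ_i`; the value `none` is the extra element `0`. -/
noncomputable def eOp (e : ℕ) (m : ℤ) (i : ZMod e) (lam : YoungDiagram) : Option YoungDiagram :=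
  (normalRemovable e m i lam).head?.map (removeNode lam)

/-- The power `f̃_i ^ t`, with `f̃_i 0 = 0`. -/
noncomputable def fPow (e : ℕ) (m : ℤ) (i : ZMod e) (t : ℕ) (lam : YoungDiagram) :
    Option YoungDiagram :=
  (fun o : Option YoungDiagram => o.bind (fOp e m i))^[t] (some lam)

/-- The power `ẽ_i ^ t`, with `ẽ_i 0 = 0`. -/
noncomputable def ePow (e : ℕ) (m : ℤ) (i : ZMod e) (t : ℕ) (lam : YoungDiagram) :
    Option YoungDiagram :=
  (fun o : Option YoungDiagram => o.bind (eOp e m i))^[t] (some lam)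

/-- `φ_i(lam) = max {k | f̃_i ^ k lam ≠ 0}` (the maximum exists, see `phi_isGreatest`). -/
noncomputable def phi (e : ℕ) (m : ℤ) (i : ZMod e) (lam : YoungDiagram) : ℕ :=
  sSup {k : ℕ | fPow e m i k lam ≠ none}

/-- `f̃_i^max lam = f̃_i ^ φ_i(lam) lam`. -/
noncomputable def fMax (e : ℕ) (m : ℤ) (i : ZMod e) (lam : YoungDiagram) : Option YoungDiagram :=
  fPow e m i (phi e m i lam) lam

theorem isAddable_finite (e : ℕ) (m : ℤ) (i : ZMod e) (lam : YoungDiagram) :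
    {x | IsAddable e m i lam x}.Finite := by
  refine (Finset.finite_toSet
    (Finset.range (lam.colLen 0 + 1) ×ˢ Finset.range (lam.rowLen 0 + 1))).subset ?_
  rintro ⟨a, b⟩ ⟨h1, h2, -⟩
  have hlow : ∀ z : ℕ × ℕ, z ≤ (a, b) → z ≠ (a, b) → z ∈ lam := by
    intro z hz hne
    have := h2 hz (by simp)
    simp only [Finset.coe_insert, Set.mem_insert_iff, hne, false_or, Finset.mem_coe] at this
    exact this
  simp only [Finset.coe_product, Finset.coe_range, Set.mem_prod, Set.mem_Iio]
  constructor
  · by_contra hc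
    have := hlow (a - 1, 0) ⟨by simp, by simp⟩ (by
      intro h
      have := congrArg Prod.fst h
      simp only at this
      omega)
    rw [YoungDiagram.mem_iff_lt_colLen] at this
    omega
  · by_contra hc
    have := hlow (0, b - 1) ⟨by simp, by simp⟩ (by
      intro h
      have := congrArg Prod.snd h
      simp only at this
      omega)
    rw [YoungDiagram.mem_iff_lt_rowLen] at this
    omega

theorem fOp_spec {e : ℕ} {m : ℤ} {i : ZMod e} {lam mu : YoungDiagram}
    (h : fOp e m i lam = some mu) :
    ∃ x, IsAddable e m i lam x ∧ mu.cells = insert x lam.cells := by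
  have hsub : ∀ u v : List Letter, Relation.ReflTransGen RAStep u v → v ⊆ u := by
    intro u v huv
    induction huv with
    | refl => exact List.Subset.refl _
    | tail _ h2 ih =>
      refine List.Subset.trans ?_ ih
      cases h2 with
      | del p q x y =>
        intro z hz
        simp only [List.mem_append, List.mem_cons] at hz ⊢
        tauto
  obtain ⟨x, hx, rfl⟩ := Option.map_eq_some_iff.1 h
  have hx1 := List.mem_of_getLast? hx
  obtain ⟨l, hl, hlx⟩ := List.mem_filterMap.1 hx1
  have hl2 := hsub _ _ (raReduce_reaches _) hl
  cases l with
  | R y => simp at hlx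
  | A y =>
    obtain rfl : y = x := by simpa using hlx
    obtain ⟨k, -, hk⟩ := List.mem_flatMap.1 hl2
    have hadd : IsAddable e m i lam y := by
      unfold rowLetters at hk
      rcases List.mem_append.1 hk with hk | hk
      · split_ifs at hk <;> simp at hk
      · split_ifs at hk with hA
        · obtain rfl : y = (k, lam.rowLen k) := by simpa using hk
          exact hA
        · simp at hk
    refine ⟨y, hadd, ?_⟩
    rw [addNode, dif_pos hadd.2.1]

theorem isAddable_of_insert {e : ℕ} (he : 2 ≤ e) {m : ℤ} {i : ZMod e} {lam mu : YoungDiagram}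
    {x y : ℕ × ℕ} (hx : IsAddable e m i lam x) (hmu : mu.cells = insert x lam.cells)
    (hy : IsAddable e m i mu y) : IsAddable e m i lam y ∧ y ≠ x := by
  have h01 : (1 : ZMod e) ≠ 0 := by
    have : Fact (1 < e) := ⟨he⟩
    exact one_ne_zero
  obtain ⟨hy1, hy2, hy3⟩ := hy
  rw [hmu, Finset.mem_insert, not_or] at hy1
  have hlow : ∀ z, z ≤ y → z ≠ y → z = x ∨ z ∈ lam.cells := by
    intro z hz hne
    have := hy2 hz (by simp)
    rw [Finset.mem_coe, Finset.mem_insert, hmu, Finset.mem_insert] at this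
    exact this.resolve_left hne
  have hxy : ¬ x ≤ y := by
    intro hle
    obtain ⟨a, b⟩ := x
    obtain ⟨c, d⟩ := y
    have hac : a ≤ c := hle.1
    have hbd : b ≤ d := hle.2
    have hstep : ∀ z : ℕ × ℕ, (a, b) ≤ z → z ≠ (a, b) → z ≤ (c, d) → z = (c, d) := by
      intro z h1 h2 h3
      by_contra hne
      rcases hlow z h3 hne with h | h
      · exact h2 h
      · exact hx.1 (lam.isLowerSet h1 h)
    have hres : residue e m (a, b) = residue e m (c, d) := hx.2.2.trans hy3.symm
    by_cases hca : a = c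
    · have hdb : b ≠ d := by
        rintro rfl
        exact hy1.1 (by rw [hca])
      have h := hstep (a, b + 1) ⟨le_rfl, Nat.le_succ b⟩ (by simp) ⟨hac, by omega⟩
      rw [← h] at hres
      simp only [residue] at hres
      push_cast at hres
      exact h01 (by linear_combination -hres)
    · have h := hstep (a + 1, b) ⟨Nat.le_succ a, le_rfl⟩ (by simp) ⟨by omega, hbd⟩
      rw [← h] at hres
      simp only [residue] at hres
      push_cast at hres
      exact h01 (by linear_combination hres)
  refine ⟨⟨hy1.2, ?_, hy3⟩, hy1.1⟩
  intro w z hzw hw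
  rw [Finset.mem_coe, Finset.mem_insert] at hw ⊢
  rcases hw with rfl | hw
  · by_cases hne : z = w
    · exact Or.inl hne
    · rcases hlow z hzw hne with rfl | h
      · exact absurd hzw hxy
      · exact Or.inr h
  · exact Or.inr (lam.isLowerSet hzw hw)

theorem fPow_bound {e : ℕ} (he : 2 ≤ e) (m : ℤ) (i : ZMod e) (k : ℕ) (lam : YoungDiagram)
    (h : fPow e m i k lam ≠ none) : k ≤ {x | IsAddable e m i lam x}.ncard := by
  induction k generalizing lam with
  | zero => exact Nat.zero_le _
  | succ k ih =>
    rw [fPow, Function.iterate_succ_apply, Option.bind_some] at h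
    cases hf : fOp e m i lam with
    | none =>
      rw [hf] at h
      exact absurd (Function.iterate_fixed (f := fun o : Option YoungDiagram =>
        o.bind (fOp e m i)) rfl k) h
    | some mu =>
      rw [hf] at h
      have hk := ih mu h
      obtain ⟨x, hx, hmu⟩ := fOp_spec hf
      have hlt : {y | IsAddable e m i mu y}.ncard < {y | IsAddable e m i lam y}.ncard := by
        refine Set.ncard_lt_ncard ⟨fun y hy => (isAddable_of_insert he hx hmu hy).1, fun hh => ?_⟩
          (isAddable_finite e m i lam)
        exact (isAddable_of_insert he hx hmu (hh hx)).2 rfl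
      omega

theorem phi_isGreatest {e : ℕ} (he : 2 ≤ e) (m : ℤ) (i : ZMod e) (lam : YoungDiagram) :
    IsGreatest {k : ℕ | fPow e m i k lam ≠ none} (phi e m i lam) := by
  have hb : BddAbove {k : ℕ | fPow e m i k lam ≠ none} :=
    ⟨_, fun k hk => fPow_bound he m i k lam hk⟩
  exact ⟨Nat.sSup_mem ⟨0, by simp [fPow]⟩ hb, fun k hk => le_csSup hb hk⟩

/-! ### The Weyl group action on the crystal -/

/-- The entry `α_j(h_i)` of the Cartan matrix of type `A^{(1)}_{e-1}`
(it is `-2` for `e = 2` and `i ≠ j`). -/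
def cartan (e : ℕ) (i j : ZMod e) : ℤ :=
  (if j = i then 2 else 0) - (if j = i + 1 then 1 else 0) - (if j = i - 1 then 1 else 0)

/-- `wt(lam)(h_i)`, where `wt(lam) = Λ_m - ∑_j N_j(lam) α_j` and `N_j(lam)` is the number of
`j`-nodes of `lam`; the sum is taken node by node. -/
def wtPairing (e : ℕ) (m : ℤ) (i : ZMod e) (lam : YoungDiagram) : ℤ :=
  (if (m : ZMod e) = i then 1 else 0) - ∑ x ∈ lam.cells, cartan e i (residue e m x)

/-- The action of the simple reflection `s_i` on the crystal. -/
noncomputable def sRefl (e : ℕ) (m : ℤ) (i : ZMod e) (lam : YoungDiagram) : Option YoungDiagram :=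
  if 0 ≤ wtPairing e m i lam then fPow e m i (wtPairing e m i lam).toNat lam
  else ePow e m i (-wtPairing e m i lam).toNat lam

/-! ### Beta numbers, `down` and `base` -/

/-- The beta number `j_k = lam_k + m - k`. -/
def betaNum (m : ℤ) (lam : YoungDiagram) (k : ℕ) : ℤ := (lam.rowLen k : ℤ) + m - k

/-- The set `J` of beta numbers of charge `m` of `lam`. -/
def betaSet (m : ℤ) (lam : YoungDiagram) : Set ℤ := Set.range (betaNum m lam)

open Classical in
/-- The partition with a given set of beta numbers of charge `m`. -/
noncomputable def ofBetaSet (m : ℤ) (J : Set ℤ) : YoungDiagram :=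
  if h : ∃ lam, betaSet m lam = J then h.choose else ⊥

/-- The beads that may be slid up by one in their runners. -/
def U (e : ℕ) (J : Set ℤ) : Set ℤ := {x | x ∈ J ∧ x - (e : ℤ) ∉ J}

/-- `p' = min U(J)`. -/
noncomputable def pMin (e : ℕ) (J : Set ℤ) : ℤ := sInf (U e J)

/-- `W(J) = {x > p' - e | x ∈ J, x + e ∉ J} ∪ {p'}`. -/
def W (e : ℕ) (J : Set ℤ) : Set ℤ :=
  {x | pMin e J - (e : ℤ) < x ∧ x ∈ J ∧ x + (e : ℤ) ∉ J} ∪ {pMin e J}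

/-- `q' = min W(J)`. -/
noncomputable def qMin (e : ℕ) (J : Set ℤ) : ℤ := sInf (W e J)

open Classical in
/-- Move the bead `q'` to `p' - e`, if `U(J)` is non-empty. -/
noncomputable def downSet (e : ℕ) (J : Set ℤ) : Set ℤ :=
  if U e J = ∅ then J else (J \ {qMin e J}) ∪ {pMin e J - (e : ℤ)}

/-- The partition `down(lam)`. -/
noncomputable def down (e : ℕ) (m : ℤ) (lam : YoungDiagram) : YoungDiagram :=
  ofBetaSet m (downSet e (betaSet m lam))

/-- `base(lam)`: apply `down` until `U(J)` is empty
(this happens after finitely many steps, see `exists_iterate_down`). -/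
noncomputable def base (e : ℕ) (m : ℤ) (lam : YoungDiagram) : YoungDiagram :=
  (down e m)^[sInf {n : ℕ | U e (betaSet m ((down e m)^[n] lam)) = ∅}] lam

/-! ### The operation `down` is well defined and terminates -/

theorem betaNum_strictAnti (m : ℤ) (lam : YoungDiagram) : StrictAnti (betaNum m lam) := by
  refine strictAnti_nat_of_succ_lt fun k => ?_
  have := lam.rowLen_anti k (k + 1) (Nat.le_succ k)
  simp only [betaNum]
  push_cast
  omega

theorem betaSet_injective (m : ℤ) : Function.Injective (betaSet m) := by
  intro lam mu h
  have h1 : betaNum m lam = betaNum m mu := by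
    have hl : StrictMono (OrderDual.toDual ∘ betaNum m lam) := (betaNum_strictAnti m lam).dual_right
    have hm : StrictMono (OrderDual.toDual ∘ betaNum m mu) := (betaNum_strictAnti m mu).dual_right
    have := (StrictMono.range_inj hl hm).1 (by
      rw [Set.range_comp, Set.range_comp]
      exact congrArg _ h)
    exact this
  have h2 : ∀ k, lam.rowLen k = mu.rowLen k := by
    intro k
    have := congrFun h1 k
    simp only [betaNum] at this
    omega
  apply YoungDiagram.ext
  ext ⟨a, b⟩
  rw [YoungDiagram.mem_cells, YoungDiagram.mem_cells, YoungDiagram.mem_iff_lt_rowLen,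
    YoungDiagram.mem_iff_lt_rowLen, h2]

theorem betaSet_ofBetaSet {m : ℤ} {J : Set ℤ} (h : ∃ lam, betaSet m lam = J) :
    betaSet m (ofBetaSet m J) = J := by
  unfold ofBetaSet
  rw [dif_pos h]
  exact h.choose_spec

theorem exists_slide_one (m : ℤ) (lam : YoungDiagram) (q : ℤ) (hq : q ∈ betaSet m lam)
    (hq1 : q - 1 ∉ betaSet m lam) :
    ∃ mu : YoungDiagram, betaSet m mu = (betaSet m lam \ {q}) ∪ {q - 1} ∧ mu.card < lam.card := by
  obtain ⟨k, rfl⟩ := hq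
  have hk : lam.rowLen (k + 1) < lam.rowLen k := by
    have h1 := lam.rowLen_anti k (k + 1) (Nat.le_succ k)
    rcases h1.lt_or_eq with h | h
    · exact h
    · exfalso
      apply hq1
      refine ⟨k + 1, ?_⟩
      simp only [betaNum, h]
      push_cast
      ring
  let x : ℕ × ℕ := (k, lam.rowLen k - 1)
  have hx : x ∈ lam.cells := by
    rw [YoungDiagram.mem_cells, YoungDiagram.mem_iff_lt_rowLen]
    omega
  have hlow : IsLowerSet ((lam.cells.erase x : Finset (ℕ × ℕ)) : Set (ℕ × ℕ)) := by
    rintro ⟨a, b⟩ ⟨c, d⟩ hcd hab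
    simp only [Finset.coe_erase, Set.mem_sdiff, Finset.mem_coe, Set.mem_singleton_iff] at hab ⊢
    refine ⟨lam.isLowerSet hcd hab.1, ?_⟩
    intro hxx
    obtain ⟨rfl, rfl⟩ := Prod.mk.inj hxx
    apply hab.2
    have h1 := hab.1
    rw [YoungDiagram.mem_cells, YoungDiagram.mem_iff_lt_rowLen] at h1
    have hca : c ≤ a := hcd.1
    have hdb : lam.rowLen c - 1 ≤ b := hcd.2
    rcases hca.eq_or_lt with rfl | hlt
    · exact Prod.ext rfl (by show b = lam.rowLen c - 1; omega)
    · have := lam.rowLen_anti (c + 1) a hlt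
      omega
  let mu : YoungDiagram := ⟨lam.cells.erase x, hlow⟩
  have hmem : ∀ a b, (a, b) ∈ mu ↔ (a, b) ≠ x ∧ (a, b) ∈ lam := by
    intro a b
    rw [← YoungDiagram.mem_cells, ← YoungDiagram.mem_cells]
    exact Finset.mem_erase
  have hne : ∀ l, l ≠ k → mu.rowLen l = lam.rowLen l := by
    intro l hl
    apply eq_of_forall_lt_iff
    intro b
    rw [← YoungDiagram.mem_iff_lt_rowLen, ← YoungDiagram.mem_iff_lt_rowLen, hmem]
    refine ⟨fun h => h.2, fun h => ⟨fun h' => hl (congrArg Prod.fst h'), h⟩⟩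
  have heq : mu.rowLen k = lam.rowLen k - 1 := by
    apply eq_of_forall_lt_iff
    intro b
    rw [← YoungDiagram.mem_iff_lt_rowLen, hmem, YoungDiagram.mem_iff_lt_rowLen]
    have : (k, b) ≠ x ↔ b ≠ lam.rowLen k - 1 := by
      simp [x]
    rw [this]
    omega
  have bne : ∀ l, l ≠ k → betaNum m mu l = betaNum m lam l := by
    intro l hl
    simp only [betaNum, hne l hl]
  have beq : betaNum m mu k = betaNum m lam k - 1 := by
    simp only [betaNum, heq]
    omega
  refine ⟨mu, ?_, Finset.card_erase_lt_of_mem hx⟩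
  ext y
  constructor
  · rintro ⟨l, rfl⟩
    by_cases hl : l = k
    · subst hl
      right
      exact beq
    · left
      rw [bne l hl]
      exact ⟨⟨l, rfl⟩, fun h => hl ((betaNum_strictAnti m lam).injective h)⟩
  · rintro (⟨⟨l, rfl⟩, hl⟩ | hy)
    · have : l ≠ k := by
        rintro rfl
        exact hl rfl
      exact ⟨l, bne l this⟩
    · exact ⟨k, beq.trans hy.symm⟩

theorem exists_slide (m : ℤ) (n : ℕ) : ∀ (lam : YoungDiagram) (q r : ℤ), q ∈ betaSet m lam →
    r ∉ betaSet m lam → q - r = n + 1 →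
    ∃ mu : YoungDiagram, betaSet m mu = (betaSet m lam \ {q}) ∪ {r} ∧ mu.card < lam.card := by
  induction n with
  | zero =>
    intro lam q r hq hr h
    have : r = q - 1 := by push_cast at h; omega
    subst this
    exact exists_slide_one m lam q hq hr
  | succ n ih =>
    intro lam q r hq hr h
    have h' : q - 1 - r = n + 1 := by push_cast at h; omega
    have hne : q - 1 ≠ r := by omega
    have hqr : q ≠ r := fun hh => hr (hh ▸ hq)
    by_cases hq1 : q - 1 ∈ betaSet m lam
    · obtain ⟨nu, hnu, hc⟩ := ih lam (q - 1) r hq1 hr h'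
      obtain ⟨mu, hmu, hc'⟩ := exists_slide_one m nu q
        (by rw [hnu]; exact Or.inl ⟨hq, fun hh => by rw [Set.mem_singleton_iff] at hh; omega⟩)
        (by rw [hnu]; simp [hne])
      refine ⟨mu, ?_, hc'.trans hc⟩
      rw [hmu, hnu]
      ext y
      simp only [Set.mem_union, Set.mem_sdiff, Set.mem_singleton_iff]
      constructor
      · rintro (⟨⟨h1, h2⟩ | h1, h3⟩ | h1)
        · exact Or.inl ⟨h1, h3⟩
        · exact Or.inr h1
        · exact Or.inl ⟨h1 ▸ hq1, by omega⟩
      · rintro (⟨h1, h2⟩ | h1)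
        · by_cases h3 : y = q - 1
          · exact Or.inr h3
          · exact Or.inl ⟨Or.inl ⟨h1, h3⟩, h2⟩
        · exact Or.inl ⟨Or.inr h1, by omega⟩
    · obtain ⟨nu, hnu, hc⟩ := exists_slide_one m lam q hq hq1
      obtain ⟨mu, hmu, hc'⟩ := ih nu (q - 1) r
        (by rw [hnu]; exact Or.inr rfl)
        (by rw [hnu]; simp [hr, Ne.symm hne]) h'
      refine ⟨mu, ?_, hc'.trans hc⟩
      rw [hmu, hnu]
      ext y
      simp only [Set.mem_union, Set.mem_sdiff, Set.mem_singleton_iff]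
      constructor
      · rintro (⟨⟨h1, h2⟩ | h1, h3⟩ | h1)
        · exact Or.inl ⟨h1, h2⟩
        · exact absurd h1 h3
        · exact Or.inr h1
      · rintro (⟨h1, h2⟩ | h1)
        · exact Or.inl ⟨Or.inl ⟨h1, h2⟩, fun h3 => hq1 (h3 ▸ h1)⟩
        · exact Or.inr h1

theorem exists_le_subset_betaSet (m : ℤ) (lam : YoungDiagram) :
    ∃ s : ℤ, ∀ x ≤ s, x ∈ betaSet m lam := by
  refine ⟨m - lam.colLen 0, fun x hx => ⟨(m - x).toNat, ?_⟩⟩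
  have h0 : lam.rowLen (m - x).toNat = 0 := by
    by_contra hne
    have h1 : ((m - x).toNat, 0) ∈ lam := by
      rw [YoungDiagram.mem_iff_lt_rowLen]
      omega
    rw [YoungDiagram.mem_iff_lt_colLen] at h1
    omega
  simp only [betaNum, h0]
  omega

theorem pMin_mem (e : ℕ) (m : ℤ) (lam : YoungDiagram) (h : U e (betaSet m lam) ≠ ∅) :
    pMin e (betaSet m lam) ∈ U e (betaSet m lam) := by
  obtain ⟨s, hs⟩ := exists_le_subset_betaSet m lam
  refine Int.csInf_mem (Set.nonempty_iff_ne_empty.2 h) ⟨s, fun x hx => ?_⟩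
  by_contra hlt
  exact hx.2 (hs _ (by omega))

theorem qMin_mem (e : ℕ) (J : Set ℤ) : qMin e J ∈ W e J := by
  refine Int.csInf_mem ⟨_, Or.inr rfl⟩ ⟨pMin e J - e, fun x hx => ?_⟩
  rcases hx with hx | hx
  · exact hx.1.le
  · rw [Set.mem_singleton_iff] at hx
    omega

theorem down_spec (e : ℕ) (m : ℤ) (lam : YoungDiagram) :
    betaSet m (down e m lam) = downSet e (betaSet m lam) ∧
      (U e (betaSet m lam) ≠ ∅ → (down e m lam).card < lam.card) := by
  by_cases hU : U e (betaSet m lam) = ∅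
  · refine ⟨betaSet_ofBetaSet ⟨lam, ?_⟩, fun h => absurd hU h⟩
    rw [downSet, if_pos hU]
  · have hp := pMin_mem e m lam hU
    have hq := qMin_mem e (betaSet m lam)
    have hqJ : qMin e (betaSet m lam) ∈ betaSet m lam := by
      rcases hq with hq | hq
      · exact hq.2.1
      · rw [Set.mem_singleton_iff] at hq
        rw [hq]
        exact hp.1
    have hge : pMin e (betaSet m lam) - e ≤ qMin e (betaSet m lam) := by
      rcases hq with hq | hq
      · exact hq.1.le
      · rw [Set.mem_singleton_iff] at hq
        omega
    have hne : pMin e (betaSet m lam) - e ≠ qMin e (betaSet m lam) :=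
      fun h => hp.2 (h ▸ hqJ)
    obtain ⟨mu, hmu, hc⟩ := exists_slide m
      (qMin e (betaSet m lam) - (pMin e (betaSet m lam) - e) - 1).toNat lam
      (qMin e (betaSet m lam)) (pMin e (betaSet m lam) - e) hqJ hp.2 (by omega)
    have hd : downSet e (betaSet m lam) = betaSet m mu := by
      rw [downSet, if_neg hU, hmu]
    have hs : betaSet m (down e m lam) = downSet e (betaSet m lam) :=
      betaSet_ofBetaSet ⟨mu, hd.symm⟩
    refine ⟨hs, fun _ => ?_⟩
    rw [betaSet_injective m (hs.trans hd)]
    exact hc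

theorem exists_iterate_down (e : ℕ) (m : ℤ) (lam : YoungDiagram) :
    ∃ n : ℕ, U e (betaSet m ((down e m)^[n] lam)) = ∅ := by
  induction hn : lam.card using Nat.strong_induction_on generalizing lam with
  | _ c ih =>
    by_cases hU : U e (betaSet m lam) = ∅
    · exact ⟨0, hU⟩
    · obtain ⟨n, h⟩ := ih _ (hn ▸ (down_spec e m lam).2 hU) (down e m lam) rfl
      exact ⟨n + 1, by simpa [Function.iterate_succ_apply] using h⟩

end KashiwaraBase

/-!
The base of a partition can be computed without the operation `down`. Insert the beads of `J` in
increasing order, each according to its residue only: inserting a bead of residue `r` into a set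
`C` of integers deletes, in every interval `[M, M + e)` with `M ≡ r` that meets `C`, the least
element, and puts in `M + e` instead (`insertBead`). Started from all integers up to some `s`, this
yields the set of beta numbers of `base(lam)` (`betaSet_base`).

On sets of beads there is also the operator that sorts the runners `i` and `i + 1`
(`sortRunners`); it is `s_i` on a core with an addable `i`-node, and the identity on a core
without one. Insertion is, up to a shift by one, a product of `e - 1` of these sorting operators,
which satisfy the relations of the affine `0`-Hecke monoid. Hence
* inserting `i` after sorting is the same as inserting `i`;
* inserting `i + 1` after sorting is the same as sorting after inserting `i`;
* after inserting `i + 1`, sorting changes nothing;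
* insertion in any other runner commutes with sorting.

These identities hold for all sets of integers and are proved pointwise. They match the
tensor product rule for `f̃_i` on the sequence of beta numbers, where a bead of residue `i` counts
as `A` and a bead of residue `i + 1` as `R`. So an induction on the number of beads shows that the
result of the insertion does not change under `f̃_i ^ t` as long as `t < φ_i`, and becomes sorted under
`f̃_i ^ φ_i` (`insertList_moveBeads`).

It remains to see that a step of `down` does not change the result of the insertion
(`insertBeads_slide`). Let `K` be `J` with the bead `p' - e` added; then `J` is `K` without
`p' - e` and `down` leads to `K` without `q'`. All beads `b` of `K` from `p' - e` to `q'`, except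
`q'`, have `b + e ∈ K`, and then leaving out `b` or the next bead of `K` makes no difference
(`insertBeads_diff_singleton`): the two intermediate results differ only in the least element of
each interval `[N, N + e)` with `N ≡ b`, and these are the elements that the insertion of `b + e`
deletes.
-/

namespace KashiwaraBase

/-! ### Residue classes of integers -/

theorem add_le_of_residue_eq {e : ℕ} {x y : ℤ} (h : (x : ZMod e) = y) (hlt : x < y) :
    x + e ≤ y := by
  have h1 : (e : ℤ) ∣ y - x := (ZMod.intCast_eq_intCast_iff_dvd_sub x y e).1 h
  have := Int.le_of_dvd (by omega) h1
  omega

theorem eq_of_residue_eq {e : ℕ} {x y : ℤ} (h : (x : ZMod e) = y) (h1 : x < y + e)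
    (h2 : y < x + e) : x = y := by
  rcases lt_trichotomy x y with hlt | heq | hlt
  · have := add_le_of_residue_eq h hlt
    omega
  · exact heq
  · have := add_le_of_residue_eq h.symm hlt
    omega

theorem exists_residue_window {e : ℕ} (he : 0 < e) (r : ℤ) (x : ℤ) :
    ∃ N : ℤ, (N : ZMod e) = (r : ZMod e) ∧ N < x ∧ x ≤ N + e := by
  have h0 : (0 : ℤ) < e := by exact_mod_cast he
  refine ⟨x - 1 - (x - 1 - r) % e, ?_, ?_, ?_⟩
  · rw [ZMod.intCast_eq_intCast_iff_dvd_sub]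
    have := Int.mul_ediv_add_emod (x - 1 - r) e
    exact ⟨-((x - 1 - r) / e), by linarith⟩
  · have := Int.emod_nonneg (x - 1 - r) h0.ne'
    omega
  · have := Int.emod_lt_of_pos (x - 1 - r) h0
    omega

theorem zmod_ne_add_one {e : ℕ} (he : 2 ≤ e) (i : ZMod e) : i ≠ i + 1 := by
  have : Fact (1 < e) := ⟨he⟩
  simp

/-! ### Bead insertion -/

/-- `x` is preceded in `C`, within its row, by another bead; the rows are the intervals
`[M, M + e)` with `M` of residue `r`, where an `x` of residue `r` counts as the end of a row. -/
def Preceded (e : ℕ) (r : ZMod e) (C : Set ℤ) (x : ℤ) : Prop :=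
  ∃ y ∈ C, y < x ∧ ∀ M : ℤ, (M : ZMod e) = r → M < x → M ≤ y

/-- Insertion of a bead into the runner `r`: in every interval `[M, M + e)` with `M` of residue
`r` that meets `C`, the least bead is deleted and the bead `M + e` is put in.
All intervals are treated at once. -/
def insertBead (e : ℕ) (r : ZMod e) (C : Set ℤ) : Set ℤ :=
  {x | (x ∈ C ∨ (x : ZMod e) = r) ∧ Preceded e r C x}

/-- Sorting of the runners `i` and `i + 1`: at every pair of positions `x, x + 1` with `x` of
residue `i`, a bead at `x` is moved to `x + 1` if that place is empty.
On `e`-cores with an addable `i`-node this is the simple reflection `s_i`. -/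
def sortRunners (e : ℕ) (i : ZMod e) (C : Set ℤ) : Set ℤ :=
  {x | ((x : ZMod e) = i ∧ x ∈ C ∧ x + 1 ∈ C) ∨ ((x : ZMod e) = i + 1 ∧ (x ∈ C ∨ x - 1 ∈ C)) ∨
    ((x : ZMod e) ≠ i ∧ (x : ZMod e) ≠ i + 1 ∧ x ∈ C)}

section sort

variable {e : ℕ} {i r : ZMod e} {C : Set ℤ} {x : ℤ}

theorem cast_add_one_eq (h : (x : ZMod e) = i) : ((x + 1 : ℤ) : ZMod e) = i + 1 := by
  push_cast
  rw [h]

theorem cast_sub_one_eq (h : (x : ZMod e) = i + 1) : ((x - 1 : ℤ) : ZMod e) = i := by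
  push_cast
  rw [h]
  ring

theorem mem_sortRunners_left (he : 2 ≤ e) (hx : (x : ZMod e) = i) :
    x ∈ sortRunners e i C ↔ x ∈ C ∧ x + 1 ∈ C := by
  have := zmod_ne_add_one he i
  simp [sortRunners, hx, this]

theorem mem_sortRunners_right (he : 2 ≤ e) (hx : (x : ZMod e) = i + 1) :
    x ∈ sortRunners e i C ↔ x ∈ C ∨ x - 1 ∈ C := by
  have := zmod_ne_add_one he i
  simp [sortRunners, hx, this.symm]

theorem mem_sortRunners_other (h1 : (x : ZMod e) ≠ i) (h2 : (x : ZMod e) ≠ i + 1) :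
    x ∈ sortRunners e i C ↔ x ∈ C := by
  simp [sortRunners, h1, h2]

theorem preceded_of_residue (hx : ((x - 1 : ℤ) : ZMod e) = r) :
    Preceded e r C x ↔ x - 1 ∈ C := by
  constructor
  · rintro ⟨y, hy, hlt, h⟩
    have := h (x - 1) hx (by omega)
    obtain rfl : y = x - 1 := by omega
    exact hy
  · intro h
    exact ⟨x - 1, h, by omega, fun M _ hM => by omega⟩

theorem preceded_iff_sub_one (hx : ((x - 1 : ℤ) : ZMod e) ≠ r) :
    Preceded e r C x ↔ Preceded e r C (x - 1) ∨ x - 1 ∈ C := by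
  constructor
  · rintro ⟨y, hy, hlt, h⟩
    by_cases hyx : y = x - 1
    · exact Or.inr (hyx ▸ hy)
    · exact Or.inl ⟨y, hy, by omega, fun M hM hlt => h M hM (by omega)⟩
  · rintro (⟨y, hy, hlt, h⟩ | h)
    · refine ⟨y, hy, by omega, fun M hM hlt => h M hM ?_⟩
      have : M ≠ x - 1 := by
        rintro rfl
        exact hx hM
      omega
    · exact ⟨x - 1, h, by omega, fun M _ hM => by omega⟩

theorem preceded_add_one (hx : x ∈ C) : Preceded e r C (x + 1) :=
  ⟨x, hx, by omega, fun M _ hM => by omega⟩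

theorem preceded_sortRunners (he : 2 ≤ e) (hr : r ≠ i + 1) (hx : (x : ZMod e) ≠ i + 1) :
    Preceded e r (sortRunners e i C) x ↔ Preceded e r C x := by
  constructor
  · rintro ⟨y, hy, hlt, h⟩
    by_cases h1 : (y : ZMod e) = i
    · exact ⟨y, ((mem_sortRunners_left he h1).1 hy).1, hlt, h⟩
    by_cases h2 : (y : ZMod e) = i + 1
    · rcases (mem_sortRunners_right he h2).1 hy with hy | hy
      · exact ⟨y, hy, hlt, h⟩
      · refine ⟨y - 1, hy, by omega, fun M hM hMx => ?_⟩
        have h3 := h M hM hMx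
        have : M ≠ y := by
          rintro rfl
          exact hr (hM.symm.trans h2)
        omega
    · exact ⟨y, (mem_sortRunners_other h1 h2).1 hy, hlt, h⟩
  · rintro ⟨y, hy, hlt, h⟩
    by_cases h1 : (y : ZMod e) = i
    · have h2 := cast_add_one_eq h1
      refine ⟨y + 1, (mem_sortRunners_right he h2).2 (Or.inr (by simpa using hy)), ?_,
        fun M hM hMx => (h M hM hMx).trans (by omega)⟩
      have : y + 1 ≠ x := by
        rintro rfl
        exact hx h2
      omega
    · refine ⟨y, ?_, hlt, h⟩
      by_cases h2 : (y : ZMod e) = i + 1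
      · exact (mem_sortRunners_right he h2).2 (Or.inl hy)
      · exact (mem_sortRunners_other h1 h2).2 hy

theorem preceded_succ_sortRunners (he : 2 ≤ e) (hx : (x : ZMod e) ≠ i + 1) :
    Preceded e (i + 1) (sortRunners e i C) x ↔ Preceded e i C x := by
  constructor
  · rintro ⟨y, hy, hlt, h⟩
    have h' : ∀ M : ℤ, (M : ZMod e) = i → M < x → M ≤ y - 1 := by
      intro M hM hMx
      have h2 := cast_add_one_eq hM
      have : M + 1 ≠ x := by
        rintro rfl
        exact hx h2
      have := h (M + 1) h2 (by omega)
      omega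
    by_cases h1 : (y : ZMod e) = i
    · exact ⟨y, ((mem_sortRunners_left he h1).1 hy).1, hlt,
        fun M hM hMx => (h' M hM hMx).trans (by omega)⟩
    by_cases h2 : (y : ZMod e) = i + 1
    · rcases (mem_sortRunners_right he h2).1 hy with hy | hy
      · exact ⟨y, hy, hlt, fun M hM hMx => (h' M hM hMx).trans (by omega)⟩
      · exact ⟨y - 1, hy, by omega, h'⟩
    · exact ⟨y, (mem_sortRunners_other h1 h2).1 hy, hlt,
        fun M hM hMx => (h' M hM hMx).trans (by omega)⟩
  · rintro ⟨y, hy, hlt, h⟩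
    have h' : ∀ M : ℤ, (M : ZMod e) = i + 1 → M < x → M ≤ y + 1 := by
      intro M hM hMx
      have := h (M - 1) (cast_sub_one_eq hM) (by omega)
      omega
    by_cases h1 : (y : ZMod e) = i
    · have h2 := cast_add_one_eq h1
      refine ⟨y + 1, (mem_sortRunners_right he h2).2 (Or.inr (by simpa using hy)), ?_, h'⟩
      have : y + 1 ≠ x := by
        rintro rfl
        exact hx h2
      omega
    · refine ⟨y, ?_, hlt, fun M hM hMx => ?_⟩
      · by_cases h2 : (y : ZMod e) = i + 1
        · exact (mem_sortRunners_right he h2).2 (Or.inl hy)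
        · exact (mem_sortRunners_other h1 h2).2 hy
      · have h3 := h' M hM hMx
        have : M ≠ y + 1 := by
          rintro rfl
          apply h1
          have := cast_sub_one_eq hM
          simpa using this
        omega

theorem insertBead_sortRunners_self (he : 2 ≤ e) :
    insertBead e i (sortRunners e i C) = insertBead e i C := by
  have hi := zmod_ne_add_one he i
  ext x
  simp only [insertBead, Set.mem_ofPred_eq]
  by_cases h2 : (x : ZMod e) = i + 1
  · have h3 := cast_sub_one_eq h2
    rw [preceded_of_residue h3, preceded_of_residue h3, mem_sortRunners_right he h2,
      mem_sortRunners_left he h3, h2, sub_add_cancel]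
    have := hi.symm
    tauto
  · rw [preceded_sortRunners he hi h2]
    by_cases h1 : (x : ZMod e) = i
    · simp [h1]
    · rw [mem_sortRunners_other h1 h2]

theorem insertBead_succ_sortRunners (he : 2 ≤ e) :
    insertBead e (i + 1) (sortRunners e i C) = sortRunners e i (insertBead e i C) := by
  have hi := zmod_ne_add_one he i
  ext x
  by_cases h1 : (x : ZMod e) = i
  · have h2 : (x : ZMod e) ≠ i + 1 := by rw [h1]; exact hi
    have h3 := cast_add_one_eq h1
    have h4 : ((x + 1 - 1 : ℤ) : ZMod e) = i := by simpa using h1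
    rw [mem_sortRunners_left he h1]
    simp only [insertBead, Set.mem_ofPred_eq]
    rw [preceded_succ_sortRunners he h2, mem_sortRunners_left he h1, preceded_of_residue h4, h1,
      h3, add_sub_cancel_right]
    have := hi.symm
    tauto
  · by_cases h2 : (x : ZMod e) = i + 1
    · have h3 := cast_sub_one_eq h2
      have h4 : ((x - 1 : ℤ) : ZMod e) ≠ i + 1 := by rw [h3]; exact hi
      rw [mem_sortRunners_right he h2]
      simp only [insertBead, Set.mem_ofPred_eq]
      rw [preceded_iff_sub_one h4, preceded_succ_sortRunners he h4, mem_sortRunners_left he h3,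
        preceded_of_residue h3, sub_add_cancel, h2, h3]
      have := hi.symm
      tauto
    · rw [mem_sortRunners_other h1 h2]
      simp only [insertBead, Set.mem_ofPred_eq]
      rw [preceded_succ_sortRunners he h2, mem_sortRunners_other h1 h2]
      tauto

theorem sortRunners_insertBead_succ (he : 2 ≤ e) :
    sortRunners e i (insertBead e (i + 1) C) = insertBead e (i + 1) C := by
  have hi := zmod_ne_add_one he i
  have key : ∀ y : ℤ, (y : ZMod e) = i → y ∈ insertBead e (i + 1) C →
      y + 1 ∈ insertBead e (i + 1) C := by
    intro y hy hmem
    refine ⟨Or.inr (cast_add_one_eq hy), preceded_add_one ?_⟩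
    rcases hmem.1 with h | h
    · exact h
    · exact absurd (hy.symm.trans h) hi
  ext x
  by_cases h1 : (x : ZMod e) = i
  · rw [mem_sortRunners_left he h1]
    exact ⟨fun h => h.1, fun h => ⟨h, key x h1 h⟩⟩
  · by_cases h2 : (x : ZMod e) = i + 1
    · rw [mem_sortRunners_right he h2]
      refine ⟨?_, Or.inl⟩
      rintro (h | h)
      · exact h
      · simpa using key _ (cast_sub_one_eq h2) h
    · exact mem_sortRunners_other h1 h2

theorem insertBead_sortRunners_comm (he : 2 ≤ e) (hr1 : r ≠ i) (hr2 : r ≠ i + 1) :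
    insertBead e r (sortRunners e i C) = sortRunners e i (insertBead e r C) := by
  have hi := zmod_ne_add_one he i
  ext x
  by_cases h1 : (x : ZMod e) = i
  · have h2 : (x : ZMod e) ≠ i + 1 := by rw [h1]; exact hi
    have h3 := cast_add_one_eq h1
    rw [mem_sortRunners_left he h1]
    simp only [insertBead, Set.mem_ofPred_eq]
    rw [preceded_sortRunners he hr2 h2, mem_sortRunners_left he h1, h1, h3]
    have : x ∈ C → Preceded e r C (x + 1) := preceded_add_one
    have := hr1.symm
    have := hr2.symm
    tauto
  · by_cases h2 : (x : ZMod e) = i + 1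
    · have h3 := cast_sub_one_eq h2
      have h4 : ((x - 1 : ℤ) : ZMod e) ≠ i + 1 := by rw [h3]; exact hi
      have h5 : ((x - 1 : ℤ) : ZMod e) ≠ r := by rw [h3]; exact hr1.symm
      rw [mem_sortRunners_right he h2]
      simp only [insertBead, Set.mem_ofPred_eq]
      rw [preceded_iff_sub_one h5, preceded_sortRunners he hr2 h4, mem_sortRunners_left he h3,
        preceded_iff_sub_one (C := C) h5, mem_sortRunners_right he h2, sub_add_cancel, h2, h3]
      have := hr1.symm
      have := hr2.symm
      tauto
    · rw [mem_sortRunners_other h1 h2]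
      simp only [insertBead, Set.mem_ofPred_eq]
      rw [preceded_sortRunners he hr2 h2, mem_sortRunners_other h1 h2]

end sort

/-! ### Insertion into sets closed under sliding -/

section insert

variable {e : ℕ} {r : ZMod e} {C : Set ℤ} {b x : ℤ}

theorem mem_insertBead_iff {M : ℤ} (hM : (M : ZMod e) = r) (h1 : M < x) (h2 : x ≤ M + e) :
    x ∈ insertBead e r C ↔ (x ∈ C ∨ x = M + e) ∧ ∃ y ∈ C, M ≤ y ∧ y < x := by
  have h3 : Preceded e r C x ↔ ∃ y ∈ C, M ≤ y ∧ y < x := by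
    constructor
    · rintro ⟨y, hy, hlt, h⟩
      exact ⟨y, hy, h M hM h1, hlt⟩
    · rintro ⟨y, hy, hle, hlt⟩
      refine ⟨y, hy, hlt, fun M' hM' hlt' => ?_⟩
      by_contra hc
      have := add_le_of_residue_eq (hM.trans hM'.symm) (by omega)
      omega
  have h4 : (x : ZMod e) = r ↔ x = M + e := by
    constructor
    · intro h
      have := add_le_of_residue_eq (hM.trans h.symm) h1
      omega
    · rintro rfl
      simp [hM]
  simp only [insertBead, Set.mem_ofPred_eq, h3, h4]

/-- `C` is closed under sliding a bead up by one in its runner. -/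
def SlideClosed (e : ℕ) (C : Set ℤ) : Prop := ∀ x ∈ C, x - (e : ℤ) ∈ C

theorem slideClosed_insertBead (hC : SlideClosed e C) : SlideClosed e (insertBead e r C) := by
  rintro x ⟨h1, y, hy, hlt, h⟩
  refine ⟨?_, y - e, hC y hy, by omega, fun M hM hlt' => ?_⟩
  · rcases h1 with h1 | h1
    · exact Or.inl (hC x h1)
    · exact Or.inr (by simpa using h1)
  · have := h (M + e) (by simpa using hM) (by omega)
    omega

theorem SlideClosed.mem_of_le (hC : SlideClosed e C) {y : ℤ} (hx : x ∈ C)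
    (h : (y : ZMod e) = x) (hle : y ≤ x) : y ∈ C := by
  obtain ⟨k, hk⟩ := (ZMod.intCast_eq_intCast_iff_dvd_sub y x e).1 h
  by_cases he : e = 0
  · subst he
    have : y = x := by
      push_cast at hk
      linarith
    exact this ▸ hx
  have h0 : (0 : ℤ) < e := by omega
  have hk0 : 0 ≤ k := by
    by_contra hc
    nlinarith
  obtain ⟨n, rfl⟩ := Int.eq_ofNat_of_zero_le hk0
  obtain rfl : y = x - e * n := by linarith
  clear hk hk0 h hle
  induction n with
  | zero => simpa using hx
  | succ n ih =>
    have := hC _ ih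
    convert this using 1
    push_cast
    ring

theorem insertBead_lt (he : 0 < e) (hC : ∀ y ∈ C, y < b) (hx : x ∈ insertBead e b C) : x ≤ b := by
  obtain ⟨M, hM, h1, h2⟩ := exists_residue_window he b x
  obtain ⟨h3, y, hy, hle, -⟩ := (mem_insertBead_iff hM h1 h2).1 hx
  have := hC y hy
  rcases h3 with h3 | h3
  · exact (hC x h3).le
  · by_contra hc
    have := add_le_of_residue_eq hM (by omega)
    omega

/-- The insertion of a bead that rests on the top of its runner puts in that bead only. -/
theorem insertBead_eq_insert (he : 0 < e) (hC : SlideClosed e C) (hlt : ∀ y ∈ C, y < b)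
    (hb : b - e ∈ C) : insertBead e b C = insert b C := by
  have hrow : ∀ M : ℤ, (M : ZMod e) = (b : ZMod e) → M < b → M ∈ C := by
    intro M hM hMb
    have := add_le_of_residue_eq hM hMb
    exact hC.mem_of_le hb (by simpa using hM) (by omega)
  ext x
  rw [Set.mem_insert_iff]
  constructor
  · intro hx
    by_cases hxb : x = b
    · exact Or.inl hxb
    · have hle := insertBead_lt he hlt hx
      rcases hx.1 with h | h
      · exact Or.inr h
      · exact Or.inr (hrow x h (by omega))
  · intro hx
    have hxb : x ≤ b := by
      rcases hx with hx | hx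
      · exact hx.le
      · exact (hlt x hx).le
    obtain ⟨M, hM, h1, h2⟩ := exists_residue_window he b x
    refine (mem_insertBead_iff hM h1 h2).2 ⟨?_, M, hrow M hM (by omega), le_rfl, h1⟩
    rcases hx with rfl | hx
    · right
      have := add_le_of_residue_eq hM h1
      omega
    · exact Or.inl hx

end insert

/-! ### Comparing insertions in different runners -/

/-- A comparison of `C` and `D` in every row `[N, N + e)` with `N` of the residue of `b`: beyond
`N + w` the beads of `C` lie in `D`, and `D` meets `[N, N + w]` if `C` does. The beads of `C` on
`[N, N + w]` other than the first one lie in `D` as well, and are not the first bead of `D` there.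
If this holds both for `C, D` and for `D, C`, then the two rows differ at most in their least
elements. -/
def RowLE (e : ℕ) (b w : ℤ) (C D : Set ℤ) : Prop :=
  ∀ N : ℤ, (N : ZMod e) = b →
    (∀ x ∈ C, N + w < x → x < N + e → x ∈ D) ∧
    (∀ y ∈ C, N ≤ y → y ≤ N + w → ∃ z ∈ D, N ≤ z ∧ z ≤ N + w) ∧
    (∀ x ∈ C, ∀ y ∈ C, N ≤ y → y < x → x ≤ N + w → x ∈ D ∧ ∃ z ∈ D, N ≤ z ∧ z < x)

section RowLE

variable {e : ℕ} {b w d : ℤ} {C D : Set ℤ}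

theorem RowLE.insertBead_subset (he : 0 < e) (h : RowLE e b w C D) (hw : w < e) :
    insertBead e b C ⊆ insertBead e b D := by
  intro x hx
  obtain ⟨N, hN, h1, h2⟩ := exists_residue_window he b x
  obtain ⟨h3, y, hy, hle, hlt⟩ := (mem_insertBead_iff hN h1 h2).1 hx
  obtain ⟨hA, hB, hC⟩ := h N hN
  rw [mem_insertBead_iff hN h1 h2]
  by_cases hxw : x ≤ N + w
  · have hxC : x ∈ C := h3.resolve_right (by omega)
    obtain ⟨h4, z, hz, h5, h6⟩ := hC x hxC y hy hle hlt hxw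
    exact ⟨Or.inl h4, z, hz, h5, h6⟩
  · constructor
    · by_cases hxe : x = N + e
      · exact Or.inr hxe
      · exact Or.inl (hA x (h3.resolve_right hxe) (by omega) (by omega))
    · by_cases hyw : y ≤ N + w
      · obtain ⟨z, hz, h5, h6⟩ := hB y hy hle hyw
        exact ⟨z, hz, h5, by omega⟩
      · exact ⟨y, hA y hy (by omega) (by omega), hle, hlt⟩

/-- The comparison `RowLE` survives the insertion in a runner that is met after `N + w`. -/
theorem RowLE.insertBead_of_lt (h : RowLE e b w C D) (hw : 0 < w) (hd1 : b + w < d)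
    (hd2 : d < b + e) : RowLE e b w (insertBead e d C) (insertBead e d D) := by
  intro N hN
  -- `E` is the position of the inserted runner in the row of `N`
  obtain ⟨E, hE, hE1⟩ : ∃ E : ℤ, (E : ZMod e) = d ∧ E - N = d - b := by
    refine ⟨N + (d - b), ?_, by ring⟩
    push_cast
    rw [hN]
    ring
  have hE' : ((E - e : ℤ) : ZMod e) = d := by simpa using hE
  obtain ⟨hA, hB, hC⟩ := h N hN
  obtain ⟨hA', -, -⟩ := h (N - e) (by simpa using hN)
  -- beads of the row segment `[E - e, z)`, where `z` is beyond `N + w`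
  have hseg : ∀ z y, N + w < z → z ≤ N + e → y ∈ C → E - e ≤ y → y < z →
      ∃ t ∈ D, E - e ≤ t ∧ t < z := by
    intro z y hz hze hy h1 h2
    by_cases h3 : y < N
    · exact ⟨y, hA' y hy (by omega) (by omega), h1, h2⟩
    · by_cases h4 : y ≤ N + w
      · obtain ⟨t, ht, h5, h6⟩ := hB y hy (by omega) h4
        exact ⟨t, ht, by omega, by omega⟩
      · exact ⟨y, hA y hy (by omega) (by omega), h1, h2⟩
  have hlow : ∀ (S : Set ℤ) x, N ≤ x → x ≤ N + w →
      (x ∈ insertBead e d S ↔ x ∈ S ∧ ∃ y ∈ S, E - e ≤ y ∧ y < x) := by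
    intro S x h1 h2
    rw [mem_insertBead_iff hE' (by omega) (by omega)]
    rw [or_iff_left (by omega : x ≠ E - e + e)]
  refine ⟨?_, ?_, ?_⟩
  · intro x hx h1 h2
    by_cases hxE : x ≤ E
    · obtain ⟨h3, y, hy, h4, h5⟩ := (mem_insertBead_iff hE' (by omega) (by omega)).1 hx
      refine (mem_insertBead_iff hE' (by omega) (by omega)).2
        ⟨h3.imp_left fun h3 => hA x h3 h1 h2, hseg x y h1 h2.le hy h4 h5⟩
    · obtain ⟨h3, y, hy, h4, h5⟩ := (mem_insertBead_iff hE (by omega) (by omega)).1 hx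
      refine (mem_insertBead_iff hE (by omega) (by omega)).2
        ⟨h3.imp_left fun h3 => hA x h3 h1 h2, y, hA y hy (by omega) (by omega), h4, h5⟩
  · intro y hy h1 h2
    obtain ⟨h3, t, ht, h4, h5⟩ := (hlow C y h1 h2).1 hy
    by_cases htN : N ≤ t
    · obtain ⟨h6, z, hz, h7, h8⟩ := hC y h3 t ht htN h5 h2
      exact ⟨y, (hlow D y h1 h2).2 ⟨h6, z, hz, by omega, h8⟩, h1, h2⟩
    · obtain ⟨z, hz, h7, h8⟩ := hB y h3 h1 h2
      exact ⟨z, (hlow D z h7 h8).2 ⟨hz, t, hA' t ht (by omega) (by omega), h4, by omega⟩, h7, h8⟩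
  · intro x hx y hy h1 h2 h3
    obtain ⟨hxC, -⟩ := (hlow C x (by omega) h3).1 hx
    obtain ⟨hyC, t, ht, h4, h5⟩ := (hlow C y h1 (by omega)).1 hy
    obtain ⟨hxD, z, hz, h6, h7⟩ := hC x hxC y hyC h1 h2 h3
    refine ⟨(hlow D x (by omega) h3).2 ⟨hxD, z, hz, by omega, h7⟩, ?_⟩
    by_cases htN : N ≤ t
    · obtain ⟨hyD, s, hs, h8, h9⟩ := hC y hyC t ht htN h5 (by omega)
      exact ⟨y, (hlow D y h1 (by omega)).2 ⟨hyD, s, hs, by omega, h9⟩, h1, h2⟩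
    · exact ⟨z, (hlow D z h6 (by omega)).2
        ⟨hz, t, hA' t ht (by omega) (by omega), h4, by omega⟩, h6, h7⟩

theorem mem_insertBead_row {X : Set ℤ} (hX : SlideClosed e X) (hw0 : 0 < w) (hwe : w < e) (hb : b + w - e ∈ X)
    {N : ℤ} (hN : (N : ZMod e) = b) :
    (N ≤ b → N ∈ insertBead e b X) ∧ ∀ x, N < x → x < N + e →
      (x ∈ insertBead e b X ↔ x ∈ X ∧ ∃ y ∈ X, N ≤ y ∧ y < x) := by
  constructor
  · intro hNb
    have hN' : ((N - e : ℤ) : ZMod e) = b := by simpa using hN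
    refine (mem_insertBead_iff hN' (by omega) (by omega)).2
      ⟨Or.inr (by omega), N - e + w, ?_, by omega, by omega⟩
    exact hX.mem_of_le hb (by simp [hN]) (by omega)
  · intro x h1 h2
    rw [mem_insertBead_iff hN h1 h2.le]
    have : x ≠ N + e := by omega
    simp [this]

theorem rowLE_insert_insertBead {X : Set ℤ} (hlt : ∀ y ∈ X, y < b)
    (hX : SlideClosed e X) (hw0 : 0 < w) (hwe : w < e) (hb : b + w - e ∈ X) :
    RowLE e b w (insert (b + w) X) (insertBead e b X) := by
  intro N hN
  obtain ⟨h0, hrow⟩ := mem_insertBead_row hX hw0 hwe hb hN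
  have hNb : ∀ y, N ≤ y → y ∈ insert (b + w) X → N ≤ b := by
    intro y hy hmem
    by_contra hc
    have := add_le_of_residue_eq hN.symm (by omega)
    rcases hmem with rfl | hmem
    · omega
    · have := hlt y hmem
      omega
  have hNw : ∀ x ∈ insert (b + w) X, N < x → x < N + e → x ≠ N + w → x ∈ X ∧ N + w ∈ X := by
    intro x hx h1 h2 h3
    have hb' := hNb x h1.le hx
    have hxX : x ∈ X := by
      rcases hx with rfl | hx
      · exfalso
        have : N = b := eq_of_residue_eq hN (by omega) (by omega)
        omega
      · exact hx
    refine ⟨hxX, hX.mem_of_le hb ?_ ?_⟩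
    · simp [hN]
    · have : N ≠ b := by
        rintro rfl
        have := hlt x hxX
        omega
      have := add_le_of_residue_eq hN (by omega)
      omega
  refine ⟨?_, ?_, ?_⟩
  · intro x hx h1 h2
    obtain ⟨h3, h4⟩ := hNw x hx (by omega) h2 (by omega)
    exact (hrow x (by omega) h2).2 ⟨h3, N + w, h4, by omega, h1⟩
  · intro y hy h1 h2
    exact ⟨N, h0 (hNb y h1 hy), le_rfl, by omega⟩
  · intro x hx y hy h1 h2 h3
    have hyb := hNb y h1 hy
    have hyX : y ∈ X := by
      rcases hy with rfl | hy
      · exfalso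
        rcases hx with hx | hx
        · omega
        · have := hlt x hx
          omega
      · exact hy
    have hNne : N < b := by
      have := hlt y hyX
      omega
    have hNe := add_le_of_residue_eq hN hNne
    have hxX : x ∈ X := by
      rcases hx with rfl | hx
      · omega
      · exact hx
    exact ⟨(hrow x (by omega) (by omega)).2 ⟨hxX, y, hyX, h1, h2⟩, N, h0 hyb, le_rfl, by omega⟩

theorem rowLE_insertBead_insert (he : 0 < e) {X : Set ℤ} (hlt : ∀ y ∈ X, y < b)
    (hX : SlideClosed e X) (hw0 : 0 < w) (hwe : w < e) (hb : b + w - e ∈ X) :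
    RowLE e b w (insertBead e b X) (insert (b + w) X) := by
  intro N hN
  obtain ⟨h0, hrow⟩ := mem_insertBead_row hX hw0 hwe hb hN
  refine ⟨?_, ?_, ?_⟩
  · intro x hx h1 h2
    exact Or.inr ((hrow x (by omega) h2).1 hx).1
  · intro y hy h1 h2
    have hyb := insertBead_lt he hlt hy
    refine ⟨N + w, ?_, by omega, le_rfl⟩
    by_cases hNb : N = b
    · exact Or.inl (by omega)
    · right
      have := add_le_of_residue_eq hN (by omega)
      exact hX.mem_of_le hb (by simp [hN]) (by omega)
  · intro x hx y hy h1 h2 h3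
    obtain ⟨h4, z, hz, h5, h6⟩ := (hrow x (by omega) (by omega)).1 hx
    exact ⟨Or.inr h4, z, Or.inr hz, h5, h6⟩

end RowLE

/-! ### Insertion of all beads of a set, in increasing order -/

open Classical in
/-- The elements of `J` in `[a, a + n)` are inserted into `C` in increasing order. -/
noncomputable def insertBeads (e : ℕ) (J : Set ℤ) (a : ℤ) : ℕ → Set ℤ → Set ℤ
  | 0, C => C
  | n + 1, C =>
    if a + n ∈ J then insertBead e ((a + n : ℤ) : ZMod e) (insertBeads e J a n C)
    else insertBeads e J a n C

section insertBeads

variable {e : ℕ} {J K : Set ℤ} {a : ℤ} {n : ℕ} {C : Set ℤ}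

theorem insertBeads_succ_of_mem (h : a + n ∈ J) :
    insertBeads e J a (n + 1) C =
      insertBead e ((a + n : ℤ) : ZMod e) (insertBeads e J a n C) := if_pos h

theorem insertBeads_succ_of_notMem (h : a + n ∉ J) :
    insertBeads e J a (n + 1) C = insertBeads e J a n C := if_neg h

theorem insertBeads_add (k : ℕ) :
    insertBeads e J a (k + n) C = insertBeads e J (a + k) n (insertBeads e J a k C) := by
  induction n with
  | zero => rfl
  | succ n ih =>
    have h : a + ((k + n : ℕ) : ℤ) = a + k + n := by
      push_cast
      ring
    rw [← add_assoc]
    by_cases hm : a + k + n ∈ J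
    · rw [insertBeads_succ_of_mem hm, insertBeads_succ_of_mem (by rwa [h]), ih, h]
    · rw [insertBeads_succ_of_notMem hm, insertBeads_succ_of_notMem (by rwa [h]), ih]

theorem insertBeads_congr (h : ∀ x, a ≤ x → x < a + n → (x ∈ J ↔ x ∈ K)) :
    insertBeads e J a n C = insertBeads e K a n C := by
  induction n with
  | zero => rfl
  | succ n ih =>
    have ih := ih fun x h1 h2 => h x h1 (by push_cast; omega)
    have hn := h (a + n) (by omega) (by push_cast; omega)
    by_cases hm : a + n ∈ J
    · rw [insertBeads_succ_of_mem hm, insertBeads_succ_of_mem (hn.1 hm), ih]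
    · rw [insertBeads_succ_of_notMem hm, insertBeads_succ_of_notMem (fun h => hm (hn.2 h)), ih]

/-- Beads that rest on beads are inserted in place. -/
theorem insertBeads_of_slide (he : 0 < e) (hJ : ∀ x, x < a → x ∈ J)
    (h : ∀ x ∈ J, x < a + n → x - e ∈ J) :
    insertBeads e J a n (Set.Iio a) = {x | x ∈ J ∧ x < a + n} := by
  induction n with
  | zero =>
    ext x
    simp only [insertBeads, Set.mem_Iio, Set.mem_ofPred_eq, Nat.cast_zero, add_zero]
    exact ⟨fun hx => ⟨hJ x hx, hx⟩, fun hx => hx.2⟩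
  | succ n ih =>
    have ih := ih fun x hx h1 => h x hx (by push_cast; omega)
    by_cases hm : a + n ∈ J
    · rw [insertBeads_succ_of_mem hm, ih, insertBead_eq_insert he]
      · ext x
        simp only [Set.mem_insert_iff, Set.mem_ofPred_eq, Nat.cast_add, Nat.cast_one]
        constructor
        · rintro (rfl | ⟨h1, h2⟩)
          · exact ⟨hm, by omega⟩
          · exact ⟨h1, by omega⟩
        · rintro ⟨h1, h2⟩
          by_cases hx : x = a + n
          · exact Or.inl hx
          · exact Or.inr ⟨h1, by omega⟩
      · rintro x ⟨h1, h2⟩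
        exact ⟨h x h1 (by push_cast; omega), by omega⟩
      · exact fun y hy => hy.2
      · exact ⟨h _ hm (by push_cast; omega), by omega⟩
    · rw [insertBeads_succ_of_notMem hm, ih]
      ext x
      simp only [Set.mem_ofPred_eq, Nat.cast_add, Nat.cast_one]
      constructor
      · rintro ⟨h1, h2⟩
        exact ⟨h1, by omega⟩
      · rintro ⟨h1, h2⟩
        have : x ≠ a + n := by
          rintro rfl
          exact hm h1
        exact ⟨h1, by omega⟩

theorem RowLE.insertBeads_of_lt {b w : ℤ} {D : Set ℤ} (h : RowLE e b w C D) (hw : 0 < w)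
    (h1 : b + w < a) (h2 : a + n ≤ b + e) :
    RowLE e b w (insertBeads e J a n C) (insertBeads e J a n D) := by
  induction n with
  | zero => exact h
  | succ n ih =>
    have ih := ih (by push_cast at h2; omega)
    by_cases hm : a + n ∈ J
    · rw [insertBeads_succ_of_mem hm, insertBeads_succ_of_mem hm]
      exact ih.insertBead_of_lt hw (by omega) (by push_cast at h2; omega)
    · rwa [insertBeads_succ_of_notMem hm, insertBeads_succ_of_notMem hm]

/-- If `b + e` belongs to the beads inserted later, it makes no difference whether the bead `b`
or the next bead `b + w` was inserted. -/
theorem insertBeads_insertBead_eq (he : 0 < e) {b w : ℤ} {X : Set ℤ} (hlt : ∀ y ∈ X, y < b)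
    (hX : SlideClosed e X) (hw0 : 0 < w) (hwe : w < e) (hb : b + w - e ∈ X)
    (ha : a = b + w + 1) (hmem : b + e ∈ J) (hn : b + e < a + n) :
    insertBeads e J a n (insertBead e ((b + w : ℤ) : ZMod e) X) =
      insertBeads e J a n (insertBead e b X) := by
  rw [insertBead_eq_insert he hX (fun y hy => (hlt y hy).trans (by omega)) hb]
  obtain ⟨k, hk⟩ : ∃ k : ℕ, a + k = b + e := ⟨(b + e - a).toNat, by omega⟩
  obtain ⟨l, rfl⟩ : ∃ l, n = k + 1 + l := ⟨n - (k + 1), by omega⟩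
  have hsplit : ∀ D, insertBeads e J a (k + 1 + l) D =
      insertBeads e J (a + (k + 1 : ℕ)) l (insertBeads e J a (k + 1) D) :=
    fun D => insertBeads_add (k + 1)
  rw [hsplit, hsplit]
  congr 1
  rw [insertBeads_succ_of_mem (by rwa [hk]), insertBeads_succ_of_mem (by rwa [hk]), hk]
  have hcast : ((b + e : ℤ) : ZMod e) = b := by simp
  rw [hcast]
  exact Set.Subset.antisymm
    (RowLE.insertBead_subset he ((rowLE_insert_insertBead hlt hX hw0 hwe hb).insertBeads_of_lt
      hw0 (by omega) (by omega)) hwe)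
    (RowLE.insertBead_subset he ((rowLE_insertBead_insert he hlt hX hw0 hwe hb).insertBeads_of_lt
      hw0 (by omega) (by omega)) hwe)

end insertBeads

/-! ### Invariance under `down` -/

section down

variable {e : ℕ} {J K : Set ℤ} {a : ℤ} {n : ℕ} {C : Set ℤ}

theorem insertBeads_eq_self (h : ∀ x, a ≤ x → x < a + n → x ∉ J) :
    insertBeads e J a n C = C := by
  induction n with
  | zero => rfl
  | succ n ih =>
    rw [insertBeads_succ_of_notMem (h _ (by omega) (by push_cast; omega)),
      ih fun x h1 h2 => h x h1 (by push_cast; omega)]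

/-- The insertion stages between `p - e` and `p`: all beads of `K` that are still to come, up to
`p`, rest on beads, except possibly the first of them. -/
theorem insertBeads_stage (he : 0 < e) {p : ℤ} (hK : ∀ x, x < a → x ∈ K)
    (hpeK : p - e ∈ K) (hslide : ∀ x ∈ K, x < p → x ≠ p - e → x - e ∈ K)
    {k : ℕ} (hk : a + k = p - e) (t : ℕ) (hkt : k ≤ t) (htp : a + t ≤ p) :
    SlideClosed e (insertBeads e K a t (Set.Iio a)) ∧
      (∀ y ∈ insertBeads e K a t (Set.Iio a), y < a + t) ∧
      ∀ c ∈ K, ∀ b ∈ K, a + t ≤ b → b < c → c ≤ p → (c < p ∨ k < t) →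
        c - e ∈ insertBeads e K a t (Set.Iio a) := by
  induction t, hkt using Nat.le_induction with
  | base =>
    rw [insertBeads_of_slide he hK fun x hx hlt => hslide x hx (by omega) (by omega)]
    refine ⟨?_, fun y hy => hy.2, ?_⟩
    · rintro x ⟨h1, h2⟩
      exact ⟨hslide x h1 (by omega) (by omega), by omega⟩
    · intro c hc b _ h1 h2 _ h4
      exact ⟨hslide c hc (by omega) (by omega), by omega⟩
  | succ t hkt ih =>
    push_cast at htp ⊢
    obtain ⟨hX, hlt, hrest⟩ := ih (by omega)
    by_cases hm : a + t ∈ K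
    · rw [insertBeads_succ_of_mem hm]
      refine ⟨slideClosed_insertBead hX, fun y hy => ?_, ?_⟩
      · have := insertBead_lt he hlt hy
        omega
      · intro c hc b hb h1 h2 h3 _
        refine ⟨?_, b - e, hrest b hb _ hm le_rfl (by omega) (by omega) (Or.inl (by omega)),
          by omega, fun M hM hMc => ?_⟩
        · by_cases h5 : c < p ∨ k < t
          · exact Or.inl (hrest c hc _ hm le_rfl (by omega) h3 h5)
          · right
            congr 1
            omega
        · have := add_le_of_residue_eq hM (by omega)
          omega
    · rw [insertBeads_succ_of_notMem hm]
      refine ⟨hX, fun y hy => (hlt y hy).trans (by omega), ?_⟩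
      intro c hc b hb h1 h2 h3 _
      refine hrest c hc b hb (by omega) h2 h3 ?_
      by_contra hcon
      push Not at hcon
      -- at the stage `t = k` the bead `p - e` itself is inserted
      exact hm (by rwa [show a + (t : ℤ) = p - e by omega])

/-- It makes no difference which of two consecutive beads `b < c` of `K` is left out,
provided that `b + e` is a bead. -/
theorem insertBeads_diff_singleton (he : 0 < e) {p b c : ℤ} (hK : ∀ x, x < a → x ∈ K)
    (hn : ∀ x ∈ K, x < a + n) (hpeK : p - e ∈ K) (hape : a ≤ p - e)
    (hslide : ∀ x ∈ K, x < p → x ≠ p - e → x - e ∈ K)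
    (hb : b ∈ K) (hc : c ∈ K) (hpb : p - e ≤ b) (hbc : b < c) (hcp : c ≤ p)
    (hgap : ∀ x, b < x → x < c → x ∉ K) (hbe : b + e ∈ K) :
    insertBeads e (K \ {b}) a n (Set.Iio a) = insertBeads e (K \ {c}) a n (Set.Iio a) := by
  obtain ⟨k, hk⟩ : ∃ k : ℕ, a + k = p - e := ⟨(p - e - a).toNat, by omega⟩
  obtain ⟨t, ht⟩ : ∃ t : ℕ, a + t = b := ⟨(b - a).toNat, by omega⟩
  obtain ⟨w, hw⟩ : ∃ w : ℕ, b + w = c := ⟨(c - b).toNat, by omega⟩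
  obtain ⟨l, rfl⟩ : ∃ l : ℕ, n = t + w + 1 + l := by
    have := hn c hc
    exact ⟨n - (t + w + 1), by omega⟩
  obtain ⟨hX, hlt, hrest⟩ :=
    insertBeads_stage he hK hpeK hslide hk t (by omega) (by omega)
  have h1 : insertBeads e (K \ {b}) a (t + w + 1) (Set.Iio a) =
      insertBead e ((c : ℤ) : ZMod e) (insertBeads e K a t (Set.Iio a)) := by
    have hcast : a + ((t + w : ℕ) : ℤ) = c := by push_cast; omega
    rw [insertBeads_succ_of_mem (by rw [hcast]; exact ⟨hc, hbc.ne'⟩), hcast, insertBeads_add,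
      insertBeads_eq_self (a := a + t)]
    · congr 1
      refine insertBeads_congr fun x h1 h2 => ⟨fun h => h.1, fun h => ⟨h, ?_⟩⟩
      rw [Set.mem_singleton_iff]
      omega
    · rintro x h1 h2 ⟨h3, h4⟩
      rw [Set.mem_singleton_iff] at h4
      exact hgap x (by omega) (by omega) h3
  have h2 : insertBeads e (K \ {c}) a (t + w + 1) (Set.Iio a) =
      insertBead e ((b : ℤ) : ZMod e) (insertBeads e K a t (Set.Iio a)) := by
    have hadd : t + w + 1 = t + 1 + w := by ring
    rw [hadd, insertBeads_add, insertBeads_eq_self (a := a + (t + 1 : ℕ)),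
      insertBeads_succ_of_mem (by rw [ht]; exact ⟨hb, hbc.ne⟩), ht]
    · congr 1
      refine insertBeads_congr fun x h1 h2 => ⟨fun h => h.1, fun h => ⟨h, ?_⟩⟩
      rw [Set.mem_singleton_iff]
      omega
    · rintro x h1 h2 ⟨h3, h4⟩
      rw [Set.mem_singleton_iff] at h4
      push_cast at h1 h2
      exact hgap x (by omega) (by omega) h3
  have hlater : ∀ d, d ≤ c → ∀ D, insertBeads e (K \ {d}) (a + (t + w + 1 : ℕ)) l D =
      insertBeads e K (a + (t + w + 1 : ℕ)) l D := by
    intro d hd D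
    refine insertBeads_congr fun x h1 h2 => ⟨fun h => h.1, fun h => ⟨h, ?_⟩⟩
    rw [Set.mem_singleton_iff]
    push_cast at h1
    omega
  rw [insertBeads_add, insertBeads_add (J := K \ {c}), h1, h2, hlater b hbc.le, hlater c le_rfl]
  by_cases hwe : (w : ℤ) < e
  · have hce := hrest c hc b hb ht.le hbc hcp (by omega)
    rw [← hw] at hce ⊢
    refine insertBeads_insertBead_eq he (fun y hy => ht ▸ hlt y hy) hX (by omega) hwe hce ?_ hbe ?_
    · push_cast
      omega
    · have := hn _ hbe
      push_cast at this ⊢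
      omega
  · -- only `b = p - e` and `c = p` remain, which lie in the same runner
    obtain rfl : c = b + e := by omega
    simp

theorem insertBeads_slide (he : 0 < e) {p q : ℤ} (hJ : ∀ x, x < a → x ∈ J)
    (hn : ∀ x ∈ J, x < a + n) (hp : p ∈ J) (hpe : p - e ∉ J)
    (hmin : ∀ x ∈ J, x < p → x - e ∈ J) (hq : q ∈ J) (hpq : p - e < q) (hqp : q ≤ p)
    (hqmin : ∀ x ∈ J, p - e < x → x < q → x + e ∈ J) :
    insertBeads e ((J \ {q}) ∪ {p - (e : ℤ)}) a n (Set.Iio a) =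
      insertBeads e J a n (Set.Iio a) := by
  have hape : a ≤ p - e := by
    by_contra hc
    exact hpe (hJ _ (by omega))
  set K : Set ℤ := insert (p - e) J with hKdef
  have hKp : p - e ∈ K := Set.mem_insert _ _
  have hJK : ∀ x ∈ J, x ∈ K := fun x hx => Set.mem_insert_of_mem _ hx
  have hcases : ∀ x ∈ K, x = p - e ∨ x ∈ J := fun x hx => hx
  have key : ∀ j : ℕ, ∀ b ∈ K, b = p - e + j → b ≤ q →
      insertBeads e (K \ {b}) a n (Set.Iio a) =
        insertBeads e (K \ {p - (e : ℤ)}) a n (Set.Iio a) := by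
    intro j
    induction j using Nat.strong_induction_on with
    | _ j ih =>
      intro b hb hbj hbq
      by_cases hb0 : b = p - e
      · rw [hb0]
      obtain ⟨c, ⟨hcK, hpc, hcb⟩, hmax⟩ := Int.exists_greatest_of_bdd
        (P := fun z => z ∈ K ∧ p - e ≤ z ∧ z < b) ⟨b, fun z hz => hz.2.2.le⟩
        ⟨p - e, hKp, le_rfl, by omega⟩
      rw [← ih (c - (p - e)).toNat (by omega) c hcK (by omega) (by omega)]
      refine (insertBeads_diff_singleton he (p := p) (fun x hx => hJK x (hJ x hx)) ?_ hKp hape ?_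
        hcK hb hpc hcb (by omega) ?_ ?_).symm
      · intro x hx
        rcases hcases x hx with rfl | hx
        · have := hn p hp
          omega
        · exact hn x hx
      · intro x hx h1 h2
        exact hJK _ (hmin x ((hcases x hx).resolve_left h2) h1)
      · intro x h1 h2 hx
        have := hmax x ⟨hx, by omega, h2⟩
        omega
      · rcases hcases c hcK with rfl | hcJ
        · simpa using hJK p hp
        · by_cases hc0 : c = p - e
          · exact absurd (hc0 ▸ hcJ) hpe
          · exact hJK _ (hqmin c hcJ (by omega) (by omega))
  have h1 : (J \ {q}) ∪ {p - (e : ℤ)} = K \ {q} := by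
    ext x
    simp only [hKdef, Set.mem_union, Set.mem_sdiff, Set.mem_singleton_iff, Set.mem_insert_iff]
    constructor
    · rintro (⟨h1, h2⟩ | h1)
      · exact ⟨Or.inr h1, h2⟩
      · exact ⟨Or.inl h1, by omega⟩
    · rintro ⟨h1 | h1, h2⟩
      · exact Or.inr h1
      · exact Or.inl ⟨h1, h2⟩
  have h2 : K \ {p - (e : ℤ)} = J := by
    ext x
    simp only [hKdef, Set.mem_sdiff, Set.mem_singleton_iff, Set.mem_insert_iff]
    constructor
    · rintro ⟨h1 | h1, h2⟩
      · exact absurd h1 h2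
      · exact h1
    · intro h
      refine ⟨Or.inr h, ?_⟩
      rintro rfl
      exact hpe h
  rw [h1, key (q - (p - e)).toNat q (hJK q hq) (by omega) le_rfl, h2]

end down

section base

variable {e : ℕ} {m : ℤ} {lam : YoungDiagram} {a : ℤ} {n : ℕ}

/-- The data that determine a step of `down`. -/
theorem down_data (he : 0 < e) (hU : U e (betaSet m lam) ≠ ∅) :
    ∃ p q : ℤ, betaSet m (down e m lam) = (betaSet m lam \ {q}) ∪ {p - (e : ℤ)} ∧
      p ∈ betaSet m lam ∧ p - e ∉ betaSet m lam ∧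
      (∀ x ∈ betaSet m lam, x < p → x - e ∈ betaSet m lam) ∧ q ∈ betaSet m lam ∧
      p - e < q ∧ q ≤ p ∧ ∀ x ∈ betaSet m lam, p - e < x → x < q → x + e ∈ betaSet m lam := by
  have hp := pMin_mem e m lam hU
  have hq := qMin_mem e (betaSet m lam)
  obtain ⟨s, hs⟩ := exists_le_subset_betaSet m lam
  have hbU : BddBelow (U e (betaSet m lam)) := by
    refine ⟨s, fun x hx => ?_⟩
    by_contra hlt
    exact hx.2 (hs _ (by omega))
  have hbW : BddBelow (W e (betaSet m lam)) := by
    refine ⟨pMin e (betaSet m lam) - e, fun x hx => ?_⟩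
    rcases hx with hx | hx
    · exact hx.1.le
    · rw [Set.mem_singleton_iff] at hx
      omega
  have hqp : qMin e (betaSet m lam) ≤ pMin e (betaSet m lam) := csInf_le hbW (Or.inr rfl)
  refine ⟨pMin e (betaSet m lam), qMin e (betaSet m lam), ?_, hp.1, hp.2, ?_, ?_, ?_, hqp, ?_⟩
  · rw [(down_spec e m lam).1, downSet, if_neg hU]
  · intro x hx hlt
    by_contra hc
    have : pMin e (betaSet m lam) ≤ x := csInf_le hbU ⟨hx, hc⟩
    omega
  · rcases hq with hq | hq
    · exact hq.2.1
    · rw [Set.mem_singleton_iff] at hq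
      rw [hq]
      exact hp.1
  · rcases hq with hq | hq
    · exact hq.1
    · rw [Set.mem_singleton_iff] at hq
      omega
  · intro x hx h1 h2
    by_contra hc
    have : qMin e (betaSet m lam) ≤ x := csInf_le hbW (Or.inl ⟨h1, hx, hc⟩)
    omega

theorem down_bounds (he : 0 < e) (ha : ∀ x, x < a → x ∈ betaSet m lam)
    (hn : ∀ x ∈ betaSet m lam, x < a + n) :
    (∀ x, x < a → x ∈ betaSet m (down e m lam)) ∧
      (∀ x ∈ betaSet m (down e m lam), x < a + n) ∧
      insertBeads e (betaSet m (down e m lam)) a n (Set.Iio a) =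
        insertBeads e (betaSet m lam) a n (Set.Iio a) := by
  by_cases hU : U e (betaSet m lam) = ∅
  · have h := (down_spec e m lam).1
    rw [downSet, if_pos hU] at h
    rw [h]
    exact ⟨ha, hn, rfl⟩
  · obtain ⟨p, q, h, hp, hpe, hmin, hq, hpq, hqp, hqmin⟩ := down_data he hU
    rw [h]
    have hape : a ≤ p - e := by
      by_contra hc
      exact hpe (ha _ (by omega))
    refine ⟨fun x hx => Or.inl ⟨ha x hx, ?_⟩, ?_,
      insertBeads_slide he ha hn hp hpe hmin hq hpq hqp hqmin⟩
    · rw [Set.mem_singleton_iff]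
      omega
    · rintro x (hx | hx)
      · exact hn x hx.1
      · rw [Set.mem_singleton_iff] at hx
        have := hn p hp
        omega

theorem U_base (e : ℕ) (m : ℤ) (lam : YoungDiagram) : U e (betaSet m (base e m lam)) = ∅ :=
  Nat.sInf_mem (exists_iterate_down e m lam)

/-- The base is obtained by inserting the beads in increasing order. -/
theorem betaSet_base (he : 0 < e) (ha : ∀ x, x < a → x ∈ betaSet m lam)
    (hn : ∀ x ∈ betaSet m lam, x < a + n) :
    betaSet m (base e m lam) = insertBeads e (betaSet m lam) a n (Set.Iio a) ∧
      ∀ x, x < a → x ∈ betaSet m (base e m lam) := by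
  have key : ∀ k : ℕ, (∀ x, x < a → x ∈ betaSet m ((down e m)^[k] lam)) ∧
      (∀ x ∈ betaSet m ((down e m)^[k] lam), x < a + n) ∧
      insertBeads e (betaSet m ((down e m)^[k] lam)) a n (Set.Iio a) =
        insertBeads e (betaSet m lam) a n (Set.Iio a) := by
    intro k
    induction k with
    | zero => exact ⟨ha, hn, rfl⟩
    | succ k ih =>
      rw [Function.iterate_succ_apply']
      obtain ⟨h1, h2, h3⟩ := down_bounds he ih.1 ih.2.1
      exact ⟨h1, h2, h3.trans ih.2.2⟩
  obtain ⟨h1, h2, h3⟩ := key (sInf {n : ℕ | U e (betaSet m ((down e m)^[n] lam)) = ∅})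
  have hU := U_base e m lam
  rw [base] at hU ⊢
  refine ⟨?_, h1⟩
  rw [← h3, insertBeads_of_slide he h1]
  · ext x
    exact ⟨fun hx => ⟨hx, h2 x hx⟩, fun hx => hx.1⟩
  · intro x hx _
    by_contra hc
    exact Set.eq_empty_iff_forall_notMem.1 hU x ⟨hx, hc⟩

end base

/-! ### Signatures of bead sequences -/

section lists

variable {e : ℕ}

/-- The number of uncancelled letters `A` in the word that has a letter `A` for every bead of
residue `i` and a letter `R` for every bead of residue `i + 1`. Here the head of the list is the
first letter of the word. -/
def phiList (i : ZMod e) : List ℤ → ℕ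
  | [] => 0
  | x :: L =>
    if (x : ZMod e) = i then phiList i L + 1
    else if (x : ZMod e) = i + 1 then phiList i L - 1 else phiList i L

/-- The last `t` of the beads with an uncancelled `A` are moved forward by one. This is meant for
`t ≤ phiList i L`; for larger `t` all of them are moved, and possibly others. -/
def moveBeads (i : ZMod e) : ℕ → List ℤ → List ℤ
  | _, [] => []
  | t, x :: L =>
    if t ≤ phiList i L then x :: moveBeads i t L else (x + 1) :: moveBeads i (phiList i L) L

/-- The entries of a list are inserted, the last one first. -/
def insertList (e : ℕ) (C : Set ℤ) (L : List ℤ) : Set ℤ :=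
  L.foldr (fun (x : ℤ) D => insertBead e (x : ZMod e) D) C

variable {i : ZMod e}

theorem phiList_cons_left {x : ℤ} {L : List ℤ} (h : (x : ZMod e) = i) :
    phiList i (x :: L) = phiList i L + 1 := by
  simp [phiList, h]

theorem phiList_cons_right (he : 2 ≤ e) {x : ℤ} {L : List ℤ} (h : (x : ZMod e) = i + 1) :
    phiList i (x :: L) = phiList i L - 1 := by
  have := (zmod_ne_add_one he i).symm
  simp only [phiList, h, this, if_true, if_false]

theorem phiList_cons_other {x : ℤ} {L : List ℤ} (h : (x : ZMod e) ≠ i)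
    (h2 : (x : ZMod e) ≠ i + 1) : phiList i (x :: L) = phiList i L := by
  simp [phiList, h, h2]

theorem moveBeads_zero (L : List ℤ) : moveBeads i 0 L = L := by
  induction L with
  | nil => rfl
  | cons x L ih => simp [moveBeads, ih]

theorem phiList_moveBeads (he : 2 ≤ e) (L : List ℤ) (t : ℕ) (ht : t ≤ phiList i L) :
    phiList i (moveBeads i t L) = phiList i L - t := by
  induction L generalizing t with
  | nil => simp [moveBeads, phiList]
  | cons x L ih =>
    by_cases h1 : (x : ZMod e) = i
    · rw [phiList_cons_left h1] at ht ⊢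
      by_cases hle : t ≤ phiList i L
      · rw [moveBeads, if_pos hle, phiList_cons_left h1, ih t hle]
        omega
      · rw [moveBeads, if_neg hle, phiList_cons_right he (cast_add_one_eq h1), ih _ le_rfl]
        omega
    · by_cases h2 : (x : ZMod e) = i + 1
      · rw [phiList_cons_right he h2] at ht ⊢
        rw [moveBeads, if_pos (by omega), phiList_cons_right he h2, ih t (by omega)]
        omega
      · rw [phiList_cons_other h1 h2] at ht ⊢
        rw [moveBeads, if_pos ht, phiList_cons_other h1 h2, ih t ht]

theorem phiList_cons_le {x : ℤ} {L : List ℤ} : phiList i (x :: L) ≤ phiList i L + 1 := by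
  rw [phiList]
  split_ifs <;> omega

theorem moveBeads_moveBeads (he : 2 ≤ e) (L : List ℤ) (s t : ℕ) (h : s + t ≤ phiList i L) :
    moveBeads i s (moveBeads i t L) = moveBeads i (s + t) L := by
  induction L generalizing s t with
  | nil => rfl
  | cons x L ih =>
    have h3 := h.trans phiList_cons_le
    by_cases hle : t ≤ phiList i L
    · have hphi := phiList_moveBeads he L t hle
      by_cases hst : s + t ≤ phiList i L
      · rw [moveBeads, if_pos hle, moveBeads, if_pos (by omega), ih s t hst, moveBeads,
          if_pos hst]
      · rw [moveBeads, if_pos hle, moveBeads, if_neg (by omega), hphi, ih _ t (by omega),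
          moveBeads, if_neg hst, Nat.sub_add_cancel hle]
    · obtain rfl : s = 0 := by omega
      rw [moveBeads_zero, zero_add]

/-- Moving fewer than all beads with an uncancelled `A` does not change the result of the
insertion, and moving all of them sorts the runners `i` and `i + 1` of the result. -/
theorem insertList_moveBeads (he : 2 ≤ e) {C : Set ℤ} (hC : sortRunners e i C = C) (L : List ℤ)
    (t : ℕ) (ht : t ≤ phiList i L) :
    insertList e C (moveBeads i t L) =
      if t < phiList i L then insertList e C L else sortRunners e i (insertList e C L) := by
  induction L generalizing t with
  | nil => simp [moveBeads, phiList, insertList, hC]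
  | cons x L ih =>
    have hcons : ∀ (y : ℤ) (M : List ℤ), insertList e C (y :: M) =
      insertBead e (y : ZMod e) (insertList e C M) := fun _ _ => rfl
    by_cases h1 : (x : ZMod e) = i
    · rw [phiList_cons_left h1] at ht ⊢
      by_cases hle : t ≤ phiList i L
      · rw [moveBeads, if_pos hle, hcons, ih t hle, hcons, h1,
          if_pos (show t < phiList i L + 1 by omega)]
        split_ifs
        · rfl
        · exact insertBead_sortRunners_self he
      · rw [moveBeads, if_neg hle, hcons, ih _ le_rfl, if_neg (lt_irrefl _),
          if_neg (show ¬ t < phiList i L + 1 by omega), hcons, cast_add_one_eq h1, h1]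
        exact insertBead_succ_sortRunners he
    · by_cases h2 : (x : ZMod e) = i + 1
      · rw [phiList_cons_right he h2] at ht ⊢
        rw [moveBeads, if_pos (by omega), hcons, ih t (by omega), hcons, h2,
          sortRunners_insertBead_succ he, ite_self]
        split_ifs with h3
        · rfl
        · -- here there is no uncancelled letter, so sorting changes nothing
          obtain rfl : t = 0 := by omega
          have h4 := ih 0 (Nat.zero_le _)
          rw [moveBeads_zero, if_neg h3] at h4
          rw [← h4]
      · rw [phiList_cons_other h1 h2] at ht ⊢
        rw [moveBeads, if_pos ht, hcons, ih t ht, hcons]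
        split_ifs
        · rfl
        · exact insertBead_sortRunners_comm he h1 h2

/-- On a strictly decreasing list, insertion in the order of the list is insertion of the beads of
the underlying set. -/
theorem insertList_eq_insertBeads (a : ℤ) (n : ℕ) (C : Set ℤ) (L : List ℤ)
    (hL : L.Pairwise (· > ·)) (h : ∀ x ∈ L, a ≤ x ∧ x < a + n) :
    insertList e C L = insertBeads e {x | x ∈ L} a n C := by
  induction n generalizing L with
  | zero =>
    cases L with
    | nil => rfl
    | cons x L =>
      have := h x (by simp)
      simp only [Nat.cast_zero, add_zero] at this
      omega
  | succ n ih =>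
    push_cast at h
    by_cases hm : a + n ∈ L
    · cases L with
      | nil => simp at hm
      | cons x L =>
        rw [List.pairwise_cons] at hL
        have hx : x = a + n := by
          rcases List.mem_cons.1 hm with h1 | h1
          · exact h1.symm
          · have h2 := hL.1 _ h1
            have := h x (by simp)
            omega
        subst hx
        rw [insertBeads_succ_of_mem hm]
        have h3 : ∀ y ∈ L, a ≤ y ∧ y < a + n := fun y hy =>
          ⟨(h y (by simp [hy])).1, hL.1 y hy⟩
        change insertBead e _ (insertList e C L) = _
        rw [ih L hL.2 h3]
        congr 1
        refine insertBeads_congr fun x h1 h2 => ?_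
        have : x ≠ a + n := by omega
        simp [this]
    · rw [insertBeads_succ_of_notMem hm]
      refine ih L hL fun x hx => ⟨(h x hx).1, ?_⟩
      have : x ≠ a + n := by
        rintro rfl
        exact hm hx
      have := (h x hx).2
      omega

/-- If every bead of residue `i + 1` has its left neighbour, no letter `R` remains uncancelled,
and moving all uncancelled `A`s sorts the runners. -/
theorem phiList_of_noRemovable (he : 2 ≤ e) (L : List ℤ) (hL : L.Pairwise (· > ·))
    (h : ∀ x ∈ L, (x : ZMod e) = i + 1 → x - 1 ∈ L) :
    (phiList i L : ℤ) = (L.map fun x : ℤ => (if (x : ZMod e) = i then (1 : ℤ) else 0) -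
      if (x : ZMod e) = i + 1 then 1 else 0).sum ∧
    {x | x ∈ moveBeads i (phiList i L) L} = sortRunners e i {x | x ∈ L} := by
  have hi := zmod_ne_add_one he i
  induction hlen : L.length using Nat.strong_induction_on generalizing L with
  | _ l ih0 =>
  cases L with
  | nil =>
    refine ⟨rfl, ?_⟩
    ext x
    simp [moveBeads, sortRunners]
  | cons x L =>
    rw [List.length_cons] at hlen
    rw [List.pairwise_cons] at hL
    by_cases h2 : (x : ZMod e) = i + 1
    · -- the bead after `x` is `x - 1`, and their letters cancel
      have hmem : x - 1 ∈ L := by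
        rcases List.mem_cons.1 (h x (by simp) h2) with h3 | h3
        · omega
        · exact h3
      have h1 := cast_sub_one_eq h2
      cases L with
      | nil => simp at hmem
      | cons y L =>
        rw [List.length_cons] at hlen
        obtain ⟨hx, hL⟩ := hL
        rw [List.pairwise_cons] at hL
        obtain rfl : y = x - 1 := by
          have h3 := hx y (by simp)
          rcases List.mem_cons.1 hmem with h4 | h4
          · exact h4.symm
          · have := hL.1 _ h4
            omega
        obtain ⟨ih1, ih2⟩ := ih0 L.length (by omega) L hL.2 (by
          intro z hz hzi
          have hzx := hL.1 z hz
          have := h z (by simp [hz]) hzi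
          simp only [List.mem_cons] at this
          rcases this with h3 | h3 | h3
          · omega
          · omega
          · exact h3) rfl
        have hphi : phiList i (x :: (x - 1) :: L) = phiList i L := by
          rw [phiList_cons_right he h2, phiList_cons_left h1]
          omega
        constructor
        · rw [hphi, ih1]
          simp only [List.map_cons, List.sum_cons, h1, h2, if_true, if_neg hi, if_neg hi.symm]
          ring
        · rw [hphi, moveBeads, if_pos (by rw [phiList_cons_left h1]; omega), moveBeads,
            if_pos le_rfl]
          rw [Set.ext_iff] at ih2
          simp only [Set.mem_ofPred_eq] at ih2
          have hnot1 : x ∉ L := fun hh => by have := hL.1 _ hh; omega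
          ext z
          simp only [Set.mem_ofPred_eq, List.mem_cons, ih2]
          have hcz : z = x → (z : ZMod e) = i + 1 := by rintro rfl; exact h2
          have hcz' : z = x - 1 → (z : ZMod e) = i := by rintro rfl; exact h1
          by_cases hz1 : (z : ZMod e) = i
          · rw [mem_sortRunners_left he hz1, mem_sortRunners_left he hz1]
            simp only [Set.mem_ofPred_eq]
            have hzx : z ≠ x := fun hh => hi (hz1.symm.trans (hcz hh))
            have e1 : z + 1 = x ↔ z = x - 1 := by omega
            have e2 : z + 1 ≠ x - 1 := fun hh =>
              hi (h1.symm.trans ((congrArg _ hh.symm).trans (cast_add_one_eq hz1)))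
            rw [e1]
            have hLx : z = x - 1 → z ∉ L := by
              rintro rfl hh
              have := hL.1 _ hh
              omega
            tauto
          · by_cases hz2 : (z : ZMod e) = i + 1
            · rw [mem_sortRunners_right he hz2, mem_sortRunners_right he hz2]
              simp only [Set.mem_ofPred_eq]
              have e1 : z - 1 = x - 1 ↔ z = x := by omega
              have e2 : z - 1 ≠ x := fun hh =>
                hi ((cast_sub_one_eq hz2).symm.trans ((congrArg _ hh).trans h2))
              have e3 : z ≠ x - 1 := fun hh => hz1 (hcz' hh)
              rw [e1]
              tauto
            · rw [mem_sortRunners_other hz1 hz2, mem_sortRunners_other hz1 hz2]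
              simp only [Set.mem_ofPred_eq]
    · obtain ⟨ih1, ih2⟩ := ih0 L.length (by omega) L hL.2 (by
        intro z hz hzi
        have hzx := hL.1 z hz
        have := h z (by simp [hz]) hzi
        rcases List.mem_cons.1 this with h3 | h3
        · omega
        · exact h3) rfl
      rw [Set.ext_iff] at ih2
      simp only [Set.mem_ofPred_eq] at ih2
      have hnot1 : x ∉ L := fun hh => by have := hL.1 _ hh; omega
      have hnot2 : x + 1 ∉ L := fun hh => by have := hL.1 _ hh; omega
      by_cases h1 : (x : ZMod e) = i
      · have h3 := cast_add_one_eq h1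
        constructor
        · rw [phiList_cons_left h1]
          push_cast
          rw [ih1]
          simp only [List.map_cons, List.sum_cons, h1, if_true, if_neg hi]
          ring
        · rw [phiList_cons_left h1, moveBeads, if_neg (by omega)]
          ext z
          simp only [Set.mem_ofPred_eq, List.mem_cons, ih2]
          by_cases hz1 : (z : ZMod e) = i
          · rw [mem_sortRunners_left he hz1, mem_sortRunners_left he hz1]
            simp only [Set.mem_ofPred_eq]
            have e1 : z ≠ x + 1 := fun hh => hi (hz1.symm.trans ((congrArg _ hh).trans h3))
            have e2 : z + 1 ≠ x := fun hh =>
              h2 ((congrArg _ hh.symm).trans (cast_add_one_eq hz1))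
            have e3 : z = x → z + 1 ∉ L := by
              rintro rfl
              exact hnot2
            tauto
          · by_cases hz2 : (z : ZMod e) = i + 1
            · rw [mem_sortRunners_right he hz2, mem_sortRunners_right he hz2]
              simp only [Set.mem_ofPred_eq]
              have e1 : z ≠ x := fun hh => h2 ((congrArg _ hh.symm).trans hz2)
              have e2 : z - 1 = x ↔ z = x + 1 := by omega
              rw [e2]
              tauto
            · rw [mem_sortRunners_other hz1 hz2, mem_sortRunners_other hz1 hz2]
              simp only [Set.mem_ofPred_eq]
              have e1 : z ≠ x := fun hh => hz1 ((congrArg _ hh).trans h1)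
              have e2 : z ≠ x + 1 := fun hh => hz2 ((congrArg _ hh).trans h3)
              tauto
      · constructor
        · rw [phiList_cons_other h1 h2, ih1]
          simp only [List.map_cons, List.sum_cons, if_neg h1, if_neg h2]
          ring
        · rw [phiList_cons_other h1 h2, moveBeads, if_pos le_rfl]
          ext z
          simp only [Set.mem_ofPred_eq, List.mem_cons, ih2]
          by_cases hz1 : (z : ZMod e) = i
          · rw [mem_sortRunners_left he hz1, mem_sortRunners_left he hz1]
            simp only [Set.mem_ofPred_eq]
            have e1 : z ≠ x := fun hh => h1 ((congrArg _ hh.symm).trans hz1)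
            have e2 : z + 1 ≠ x := fun hh =>
              h2 ((congrArg _ hh.symm).trans (cast_add_one_eq hz1))
            tauto
          · by_cases hz2 : (z : ZMod e) = i + 1
            · rw [mem_sortRunners_right he hz2, mem_sortRunners_right he hz2]
              simp only [Set.mem_ofPred_eq]
              have e1 : z ≠ x := fun hh => h2 ((congrArg _ hh.symm).trans hz2)
              have e2 : z - 1 ≠ x := fun hh =>
                h1 ((congrArg _ hh.symm).trans (cast_sub_one_eq hz2))
              tauto
            · rw [mem_sortRunners_other hz1 hz2, mem_sortRunners_other hz1 hz2]
              simp only [Set.mem_ofPred_eq]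

end lists

/-! ### Nodes and beads -/

section nodes

variable {e : ℕ} {m : ℤ} {i : ZMod e} {lam : YoungDiagram}

theorem rowLen_eq_zero {k : ℕ} (h : lam.colLen 0 ≤ k) : lam.rowLen k = 0 := by
  by_contra hne
  have h1 : (k, 0) ∈ lam := by
    rw [YoungDiagram.mem_iff_lt_rowLen]
    omega
  rw [YoungDiagram.mem_iff_lt_colLen] at h1
  omega

theorem isLowerSet_insert_iff (a b : ℕ) :
    ((a, b) ∉ lam.cells ∧
      IsLowerSet ((insert (a, b) lam.cells : Finset (ℕ × ℕ)) : Set (ℕ × ℕ))) ↔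
    b = lam.rowLen a ∧ ∀ c < a, b < lam.rowLen c := by
  simp only [YoungDiagram.mem_cells, YoungDiagram.mem_iff_lt_rowLen, not_lt]
  constructor
  · rintro ⟨h1, h2⟩
    have hlow : ∀ c d : ℕ, c ≤ a → d ≤ b → (c, d) ≠ (a, b) → d < lam.rowLen c := by
      intro c d hc hd hne
      have := h2 (show (c, d) ≤ (a, b) from ⟨hc, hd⟩) (by simp)
      simp only [Finset.coe_insert, Set.mem_insert_iff, hne, false_or, Finset.mem_coe,
        YoungDiagram.mem_cells, YoungDiagram.mem_iff_lt_rowLen] at this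
      exact this
    refine ⟨?_, fun c hc => hlow c b hc.le le_rfl (by simp; omega)⟩
    by_contra hne
    have := hlow a (b - 1) le_rfl (by omega) (by simp; omega)
    omega
  · rintro ⟨rfl, h2⟩
    refine ⟨le_rfl, ?_⟩
    rintro ⟨c, d⟩ ⟨c', d'⟩ hle hmem
    have hc : c' ≤ c := hle.1
    have hd : d' ≤ d := hle.2
    simp only [Finset.coe_insert, Set.mem_insert_iff, Finset.mem_coe,
      YoungDiagram.mem_cells, YoungDiagram.mem_iff_lt_rowLen, Prod.mk.injEq] at hmem ⊢
    rcases hmem with ⟨rfl, rfl⟩ | hmem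
    · rcases hc.lt_or_eq with h | rfl
      · have := h2 c' h
        omega
      · omega
    · have := lam.rowLen_anti c' c hc
      omega

theorem isLowerSet_erase_iff (a b : ℕ) :
    ((a, b) ∈ lam.cells ∧
      IsLowerSet ((lam.cells.erase (a, b) : Finset (ℕ × ℕ)) : Set (ℕ × ℕ))) ↔
    lam.rowLen a = b + 1 ∧ lam.rowLen (a + 1) ≤ b := by
  simp only [YoungDiagram.mem_cells, YoungDiagram.mem_iff_lt_rowLen]
  constructor
  · rintro ⟨h1, h2⟩
    have hup : ∀ c d : ℕ, a ≤ c → b ≤ d → (c, d) ≠ (a, b) → lam.rowLen c ≤ d := by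
      intro c d hc hd hne
      by_contra hlt
      have := h2 (show (a, b) ≤ (c, d) from ⟨hc, hd⟩) (by
        rw [Finset.mem_coe, Finset.mem_erase, YoungDiagram.mem_cells,
          YoungDiagram.mem_iff_lt_rowLen]
        exact ⟨hne, by omega⟩)
      simp at this
    have h3 := hup a (b + 1) le_rfl (by omega) (by simp)
    exact ⟨by omega, hup (a + 1) b (by omega) le_rfl (by simp)⟩
  · rintro ⟨h1, h2⟩
    refine ⟨by omega, ?_⟩
    rintro ⟨c, d⟩ ⟨c', d'⟩ hle hmem
    have hc : c' ≤ c := hle.1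
    have hd : d' ≤ d := hle.2
    simp only [Finset.mem_coe, Finset.mem_erase, ne_eq, Prod.mk.injEq,
      YoungDiagram.mem_cells, YoungDiagram.mem_iff_lt_rowLen] at hmem ⊢
    have h3 := lam.rowLen_anti c' c hc
    refine ⟨?_, by omega⟩
    rintro ⟨rfl, rfl⟩
    rcases hc.lt_or_eq with h | rfl
    · have := lam.rowLen_anti (c' + 1) c h
      omega
    · omega

theorem residue_rowLen (k : ℕ) :
    residue e m (k, lam.rowLen k) = ((betaNum m lam k : ℤ) : ZMod e) := by
  simp only [residue, betaNum]
  congr 1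
  ring

theorem isAddable_zero_iff :
    IsAddable e m i lam (0, lam.rowLen 0) ↔ ((betaNum m lam 0 : ℤ) : ZMod e) = i := by
  rw [IsAddable, ← and_assoc, isLowerSet_insert_iff, residue_rowLen]
  simp

theorem isAddable_succ_iff (k : ℕ) :
    IsAddable e m i lam (k + 1, lam.rowLen (k + 1)) ↔
      ((betaNum m lam (k + 1) : ℤ) : ZMod e) = i ∧
        betaNum m lam k ≠ betaNum m lam (k + 1) + 1 := by
  rw [IsAddable, ← and_assoc, isLowerSet_insert_iff, residue_rowLen, and_comm]
  refine and_congr_right fun _ => ?_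
  have h1 : betaNum m lam k ≠ betaNum m lam (k + 1) + 1 ↔
      lam.rowLen (k + 1) < lam.rowLen k := by
    have := lam.rowLen_anti k (k + 1) (Nat.le_succ k)
    simp only [betaNum]
    push_cast
    omega
  rw [h1]
  refine ⟨fun h => h.2 k (Nat.lt_succ_self k), fun h => ⟨rfl, fun c hc => ?_⟩⟩
  have := lam.rowLen_anti c k (by omega)
  omega

theorem isRemovable_iff (k : ℕ) :
    IsRemovable e m i lam (k, lam.rowLen k - 1) ↔
      ((betaNum m lam k : ℤ) : ZMod e) = i + 1 ∧
        betaNum m lam k ≠ betaNum m lam (k + 1) + 1 := by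
  rw [IsRemovable, ← and_assoc, isLowerSet_erase_iff]
  have h1 : betaNum m lam k ≠ betaNum m lam (k + 1) + 1 ↔
      lam.rowLen (k + 1) < lam.rowLen k := by
    have := lam.rowLen_anti k (k + 1) (Nat.le_succ k)
    simp only [betaNum]
    push_cast
    omega
  have h2 : (lam.rowLen k = lam.rowLen k - 1 + 1 ∧ lam.rowLen (k + 1) ≤ lam.rowLen k - 1) ↔
      lam.rowLen (k + 1) < lam.rowLen k := by omega
  rw [h1, h2, and_comm]
  refine and_congr_left fun h => ?_
  have h3 : residue e m (k, lam.rowLen k - 1) = ((betaNum m lam k : ℤ) : ZMod e) - 1 := by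
    rw [← residue_rowLen]
    simp only [residue]
    have : ((lam.rowLen k - 1 : ℕ) : ℤ) = (lam.rowLen k : ℤ) - 1 := by omega
    rw [this]
    push_cast
    ring
  rw [h3, sub_eq_iff_eq_add]

theorem exists_isAddable_iff :
    (∃ x, IsAddable e m i lam x) ↔
      ∃ y : ℤ, (y : ZMod e) = i ∧ y ∈ betaSet m lam ∧ y + 1 ∉ betaSet m lam := by
  have hrow : ∀ a b, IsAddable e m i lam (a, b) → b = lam.rowLen a := fun a b h =>
    ((isLowerSet_insert_iff a b).1 ⟨h.1, h.2.1⟩).1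
  have hanti := betaNum_strictAnti m lam
  constructor
  · rintro ⟨⟨a, b⟩, h⟩
    obtain rfl := hrow a b h
    refine ⟨betaNum m lam a, (residue_rowLen a).symm.trans h.2.2, ⟨a, rfl⟩, ?_⟩
    rintro ⟨c, hc⟩
    cases a with
    | zero =>
      have := hanti.antitone (Nat.zero_le c)
      omega
    | succ a =>
      have h2 := ((isAddable_succ_iff a).1 h).2
      rcases lt_trichotomy c a with h3 | h3 | h3
      · have := hanti h3
        have := hanti (Nat.lt_succ_self a)
        simp only [Nat.succ_eq_add_one] at this
        omega
      · exact h2 (h3 ▸ hc)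
      · have := hanti.antitone (show a + 1 ≤ c from h3)
        omega
  · rintro ⟨y, hy, ⟨a, rfl⟩, hy1⟩
    refine ⟨(a, lam.rowLen a), ?_⟩
    cases a with
    | zero => exact isAddable_zero_iff.2 hy
    | succ a => exact (isAddable_succ_iff a).2 ⟨hy, fun h => hy1 ⟨a, h⟩⟩

/-! ### Beta numbers of the first rows -/

/-- The beta numbers of the rows `k, …, k + n - 1`. -/
def betaList (m : ℤ) (lam : YoungDiagram) (k n : ℕ) : List ℤ :=
  (List.range' k n).map (betaNum m lam)

theorem betaList_succ (k n : ℕ) :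
    betaList m lam k (n + 1) = betaNum m lam k :: betaList m lam (k + 1) n := by
  simp [betaList, List.range'_succ]

theorem pairwise_betaList (k n : ℕ) : (betaList m lam k n).Pairwise (· > ·) := by
  rw [betaList, List.pairwise_map]
  exact (List.pairwise_lt_range' (s := k) (n := n)).imp fun h => betaNum_strictAnti m lam h

theorem mem_betaList_iff {N : ℕ} (hN : lam.colLen 0 ≤ N) (x : ℤ) :
    x ∈ betaList m lam 0 N ↔ x ∈ betaSet m lam ∧ m - N < x := by
  simp only [betaList, List.mem_map, List.mem_range'_1, Nat.zero_le, true_and, zero_add, betaSet,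
    Set.mem_range]
  constructor
  · rintro ⟨k, hk, rfl⟩
    refine ⟨⟨k, rfl⟩, ?_⟩
    simp only [betaNum]
    omega
  · rintro ⟨⟨k, rfl⟩, h⟩
    refine ⟨k, ?_, rfl⟩
    by_contra hk
    rw [betaNum, rowLen_eq_zero (by omega)] at h
    omega

theorem mem_betaSet_of_le {N : ℕ} (hN : lam.colLen 0 ≤ N) {x : ℤ} (hx : x ≤ m - N) :
    x ∈ betaSet m lam := by
  refine ⟨(m - x).toNat, ?_⟩
  rw [betaNum, rowLen_eq_zero (by omega)]
  omega

theorem colLen_le_of_mem_betaSet {N : ℕ} (h : ∀ x, x ≤ m - N → x ∈ betaSet m lam) :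
    lam.colLen 0 ≤ N := by
  -- an empty row below the row `N` forces the row above it to be empty
  have key : ∀ d : ℕ, lam.rowLen (N + d) = 0 → lam.rowLen N = 0 := by
    intro d
    induction d with
    | zero => exact id
    | succ d ih =>
      intro h0
      apply ih
      obtain ⟨k, hk⟩ := h (m - (N + d : ℕ)) (by push_cast; omega)
      have hlt : k < N + d + 1 := by
        rw [← (betaNum_strictAnti m lam).lt_iff_gt, hk, betaNum]
        have : lam.rowLen (N + d + 1) = 0 := h0
        rw [this]
        push_cast
        omega
      have := (betaNum_strictAnti m lam).antitone (show k ≤ N + d by omega)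
      rw [hk, betaNum] at this
      omega
  have h0 := key (lam.colLen 0) (rowLen_eq_zero (by omega))
  by_contra hlt
  have h1 : (N, 0) ∈ lam := by
    rw [YoungDiagram.mem_iff_lt_colLen]
    omega
  rw [YoungDiagram.mem_iff_lt_rowLen] at h1
  omega

theorem betaNum_of_insert {mu : YoungDiagram} {r : ℕ}
    (h : mu.cells = insert (r, lam.rowLen r) lam.cells) (k : ℕ) :
    betaNum m mu k = betaNum m lam k + if k = r then 1 else 0 := by
  have h1 : mu.rowLen k = lam.rowLen k + if k = r then 1 else 0 := by
    apply eq_of_forall_lt_iff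
    intro b
    rw [← YoungDiagram.mem_iff_lt_rowLen, ← YoungDiagram.mem_cells, h, Finset.mem_insert,
      YoungDiagram.mem_cells, YoungDiagram.mem_iff_lt_rowLen, Prod.mk.injEq]
    split_ifs with hk
    · subst hk
      simp
      omega
    · simp [hk]
  rw [betaNum, betaNum, h1]
  split_ifs <;> push_cast <;> ring

/-! ### Signatures of partitions -/

/-- The letter that row `k` contributes if all beads of residue `i` and `i + 1` are recorded,
whether or not they can be moved. -/
def beadLetters (e : ℕ) (m : ℤ) (i : ZMod e) (lam : YoungDiagram) (k : ℕ) : List Letter :=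
  if ((betaNum m lam k : ℤ) : ZMod e) = i then [Letter.A (k, lam.rowLen k)]
  else if ((betaNum m lam k : ℤ) : ZMod e) = i + 1 then [Letter.R (k, lam.rowLen k - 1)]
  else []

/-- The letter `A` of a bead of row `k` that has its right neighbour in row `k - 1`. -/
def blockedLetters (e : ℕ) (m : ℤ) (i : ZMod e) (lam : YoungDiagram) : ℕ → List Letter
  | 0 => []
  | k + 1 =>
    if ((betaNum m lam (k + 1) : ℤ) : ZMod e) = i ∧ betaNum m lam k = betaNum m lam (k + 1) + 1
    then [Letter.A (k + 1, lam.rowLen (k + 1))] else []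

end nodes

section words

variable {e : ℕ} {m : ℤ} {i : ZMod e} {lam : YoungDiagram}

theorem raReduce_cons_congr (a : Letter) {u v : List Letter} (h : raReduce u = raReduce v) :
    raReduce (a :: u) = raReduce (a :: v) := by
  cases a <;> simp [raReduce, h]

theorem raReduce_R_A_cons (x y : ℕ × ℕ) (u : List Letter) :
    raReduce (Letter.R x :: Letter.A y :: u) = raReduce u := by
  simp [raReduce]

theorem rowLetters_left (he : 2 ≤ e) (k : ℕ) (h : ((betaNum m lam k : ℤ) : ZMod e) = i) :
    blockedLetters e m i lam k ++ rowLetters e m i lam k = [Letter.A (k, lam.rowLen k)] := by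
  have hR : ¬ IsRemovable e m i lam (k, lam.rowLen k - 1) := fun hr =>
    zmod_ne_add_one he i (h.symm.trans ((isRemovable_iff k).1 hr).1)
  rw [rowLetters, if_neg hR, List.nil_append]
  cases k with
  | zero => rw [if_pos (isAddable_zero_iff.2 h)]; rfl
  | succ k =>
    rw [blockedLetters]
    simp only [isAddable_succ_iff, h, true_and]
    split_ifs <;> first | rfl | contradiction

theorem rowLetters_right (he : 2 ≤ e) (k : ℕ) (h : ((betaNum m lam k : ℤ) : ZMod e) = i + 1) :
    rowLetters e m i lam k = if betaNum m lam k = betaNum m lam (k + 1) + 1 then []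
      else [Letter.R (k, lam.rowLen k - 1)] := by
  have hA : ¬ IsAddable e m i lam (k, lam.rowLen k) := fun ha =>
    zmod_ne_add_one he i ((ha.2.2.symm.trans (residue_rowLen k)).trans h)
  rw [rowLetters, if_neg hA, List.append_nil]
  simp only [isRemovable_iff, h, true_and]
  split_ifs <;> first | rfl | contradiction

theorem rowLetters_other (k : ℕ) (h1 : ((betaNum m lam k : ℤ) : ZMod e) ≠ i)
    (h2 : ((betaNum m lam k : ℤ) : ZMod e) ≠ i + 1) : rowLetters e m i lam k = [] := by
  have hA : ¬ IsAddable e m i lam (k, lam.rowLen k) := fun ha =>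
    h1 ((residue_rowLen k).symm.trans ha.2.2)
  have hR : ¬ IsRemovable e m i lam (k, lam.rowLen k - 1) := fun hr =>
    h2 ((isRemovable_iff k).1 hr).1
  rw [rowLetters, if_neg hA, if_neg hR]
  rfl

theorem blockedLetters_eq_nil (k : ℕ) (h : ((betaNum m lam k : ℤ) : ZMod e) ≠ i) :
    blockedLetters e m i lam k = [] := by
  cases k with
  | zero => rfl
  | succ k => rw [blockedLetters, if_neg fun hh => h hh.1]

theorem blockedLetters_succ_eq_nil (k : ℕ)
    (h : ((betaNum m lam k : ℤ) : ZMod e) ≠ i + 1) :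
    blockedLetters e m i lam (k + 1) = [] := by
  rw [blockedLetters, if_neg]
  rintro ⟨h1, h2⟩
  rw [h2] at h
  exact h (cast_add_one_eq h1)

/-- Recording all beads of residue `i` and `i + 1` only adds adjacent pairs `RA`,
which come from adjacent beads. -/
theorem raReduce_beadLetters (he : 2 ≤ e) (n k : ℕ)
    (hlast : ((betaNum m lam (k + n) : ℤ) : ZMod e) ≠ i) :
    raReduce ((List.range' k n).flatMap (beadLetters e m i lam)) =
      raReduce (blockedLetters e m i lam k ++
        (List.range' k n).flatMap (rowLetters e m i lam)) := by
  induction n generalizing k with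
  | zero => simp [blockedLetters_eq_nil k hlast]
  | succ n ih =>
    have ih := ih (k + 1) (by rwa [add_right_comm])
    rw [List.range'_succ, List.flatMap_cons, List.flatMap_cons, ← List.append_assoc]
    by_cases h1 : ((betaNum m lam k : ℤ) : ZMod e) = i
    · rw [rowLetters_left he k h1, beadLetters, if_pos h1]
      rw [blockedLetters_succ_eq_nil k (by rw [h1]; exact zmod_ne_add_one he i)] at ih
      exact raReduce_cons_congr _ ih
    · rw [blockedLetters_eq_nil k h1, beadLetters, if_neg h1]
      by_cases h2 : ((betaNum m lam k : ℤ) : ZMod e) = i + 1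
      · rw [if_pos h2, rowLetters_right he k h2, List.nil_append, List.singleton_append,
          raReduce_cons_congr _ ih]
        split_ifs with h3
        · have h4 : ((betaNum m lam (k + 1) : ℤ) : ZMod e) = i := by
            have h5 : betaNum m lam (k + 1) = betaNum m lam k - 1 := by omega
            rw [h5]
            exact cast_sub_one_eq h2
          rw [blockedLetters, if_pos ⟨h4, h3⟩, List.singleton_append, raReduce_R_A_cons,
            List.nil_append]
        · rw [blockedLetters, if_neg fun h => h3 h.2, List.nil_append, List.singleton_append]
      · rw [if_neg h2, rowLetters_other k h1 h2, List.nil_append, List.nil_append, ih,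
          blockedLetters_succ_eq_nil k h2, List.nil_append]

theorem rowLetters_eq_nil {N k : ℕ} (hN : lam.colLen 0 ≤ N)
    (hi : ((m - N : ℤ) : ZMod e) ≠ i) (hk : N ≤ k) : rowLetters e m i lam k = [] := by
  have hk0 : lam.rowLen k = 0 := rowLen_eq_zero (hN.trans hk)
  have hR : ¬ IsRemovable e m i lam (k, lam.rowLen k - 1) := fun hr => by
    have := ((isLowerSet_erase_iff _ _).1 ⟨hr.1, hr.2.1⟩).1
    omega
  have hA : ¬ IsAddable e m i lam (k, lam.rowLen k) := fun ha => by
    rcases hk.eq_or_lt with rfl | hlt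
    · apply hi
      rw [← ha.2.2, residue_rowLen, betaNum, hk0]
      simp
    · have h1 := ((isLowerSet_insert_iff _ _).1 ⟨ha.1, ha.2.1⟩).2 N hlt
      have := rowLen_eq_zero (lam := lam) hN
      omega
  rw [rowLetters, if_neg hA, if_neg hR]
  rfl

theorem flatMap_range_eq {f : ℕ → List Letter} {a b : ℕ} (hab : a ≤ b)
    (h : ∀ k, a ≤ k → f k = []) : (List.range b).flatMap f = (List.range a).flatMap f := by
  induction b, hab using Nat.le_induction with
  | base => rfl
  | succ b hab ih => rw [List.range_succ, List.flatMap_append, ih]; simp [h b hab]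

theorem raReduce_word (he : 2 ≤ e) {N : ℕ} (hN : lam.colLen 0 ≤ N)
    (hi : ((m - N : ℤ) : ZMod e) ≠ i) :
    raReduce (word e m i lam) =
      raReduce ((List.range' 0 N).flatMap (beadLetters e m i lam)) := by
  have hlast : ((betaNum m lam (0 + N) : ℤ) : ZMod e) ≠ i := by
    rw [zero_add, betaNum, rowLen_eq_zero hN]
    simpa using hi
  rw [raReduce_beadLetters he N 0 hlast, blockedLetters, List.nil_append,
    ← List.range_eq_range', word]
  congr 1
  rw [← flatMap_range_eq (Nat.le_succ N) fun k hk => rowLetters_eq_nil hN hi hk]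
  refine (flatMap_range_eq (by omega) fun k hk => ?_).symm
  by_cases hNk : N ≤ k
  · exact rowLetters_eq_nil hN hi hNk
  · have hk1 : lam.rowLen k = 0 := rowLen_eq_zero (by omega)
    have hR : ¬ IsRemovable e m i lam (k, lam.rowLen k - 1) := fun hr => by
      have := ((isLowerSet_erase_iff _ _).1 ⟨hr.1, hr.2.1⟩).1
      omega
    have hA : ¬ IsAddable e m i lam (k, lam.rowLen k) := fun ha => by
      have h1 := ((isLowerSet_insert_iff _ _).1 ⟨ha.1, ha.2.1⟩).2 (k - 1) (by omega)
      have := rowLen_eq_zero (lam := lam) (show lam.colLen 0 ≤ k - 1 by omega)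
      omega
    rw [rowLetters, if_neg hA, if_neg hR]
    rfl

/-- The uncancelled letters `A` are counted by `phiList`, and the last of them is the bead that
`moveBeads` moves first. -/
theorem raReduce_beadLetters_shape (he : 2 ≤ e) (n k : ℕ) :
    ∃ p q : List (ℕ × ℕ),
      raReduce ((List.range' k n).flatMap (beadLetters e m i lam)) =
        p.map Letter.A ++ q.map Letter.R ∧
      p.length = phiList i (betaList m lam k n) ∧
      ∀ x ∈ p.getLast?, ∃ r, k ≤ r ∧ x = (r, lam.rowLen r) ∧
        moveBeads i 1 (betaList m lam k n) =
          (List.range' k n).map fun l => betaNum m lam l + if l = r then 1 else 0 := by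
  induction n generalizing k with
  | zero => exact ⟨[], [], by simp [raReduce, betaList, phiList]⟩
  | succ n ih =>
    obtain ⟨p, q, h, hlen, hlast⟩ := ih (k + 1)
    rw [List.range'_succ, List.flatMap_cons, betaList_succ]
    -- the bead of row `k` stays if a later one moves
    have hstep : ∀ x ∈ p.getLast?, ∃ r, k ≤ r ∧ x = (r, lam.rowLen r) ∧
        moveBeads i 1 (betaNum m lam k :: betaList m lam (k + 1) n) =
          (k :: List.range' (k + 1) n).map fun l => betaNum m lam l + if l = r then 1 else 0 := by
      intro x hx
      obtain ⟨r, hr, hxr, hmove⟩ := hlast x hx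
      refine ⟨r, by omega, hxr, ?_⟩
      have hpos : 1 ≤ phiList i (betaList m lam (k + 1) n) := by
        rw [← hlen]
        cases p with
        | nil => simp at hx
        | cons y p => simp
      rw [moveBeads, if_pos hpos, hmove, List.map_cons, if_neg (show k ≠ r by omega), add_zero]
    by_cases h1 : ((betaNum m lam k : ℤ) : ZMod e) = i
    · refine ⟨(k, lam.rowLen k) :: p, q, ?_, ?_, ?_⟩
      · rw [beadLetters, if_pos h1, List.singleton_append, raReduce, h]
        rfl
      · rw [phiList_cons_left h1, List.length_cons, hlen]
      · intro x hx
        cases p with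
        | nil =>
          simp only [List.getLast?_singleton, Option.mem_def, Option.some.injEq] at hx
          have h0 : phiList i (betaList m lam (k + 1) n) = 0 := hlen.symm
          refine ⟨k, le_rfl, hx.symm, ?_⟩
          rw [moveBeads, if_neg (by omega), h0, moveBeads_zero, List.map_cons, if_pos rfl,
            betaList]
          congr 1
          refine List.map_congr_left fun l hl => ?_
          rw [List.mem_range'_1] at hl
          rw [if_neg (by omega), add_zero]
        | cons y p =>
          rw [List.getLast?_cons_cons] at hx
          exact hstep x hx
    · by_cases h2 : ((betaNum m lam k : ℤ) : ZMod e) = i + 1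
      · cases p with
        | nil =>
          refine ⟨[], (k, lam.rowLen k - 1) :: q, ?_, ?_, by simp⟩
          · rw [beadLetters, if_neg h1, if_pos h2, List.singleton_append, raReduce, h]
            cases q <;> rfl
          · rw [phiList_cons_right he h2, ← hlen]
            rfl
        | cons y p =>
          refine ⟨p, q, ?_, ?_, ?_⟩
          · rw [beadLetters, if_neg h1, if_pos h2, List.singleton_append, raReduce, h]
            rfl
          · rw [phiList_cons_right he h2, ← hlen]
            rfl
          · intro x hx
            refine hstep x ?_
            cases p with
            | nil => simp at hx
            | cons z p => rwa [List.getLast?_cons_cons]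
      · refine ⟨p, q, ?_, ?_, hstep⟩
        · rw [beadLetters, if_neg h1, if_neg h2, List.nil_append, h]
        · rw [phiList_cons_other h1 h2, hlen]

theorem fOp_cases (he : 2 ≤ e) {N : ℕ} (hN : lam.colLen 0 ≤ N)
    (hi : ((m - N : ℤ) : ZMod e) ≠ i) :
    (phiList i (betaList m lam 0 N) = 0 → fOp e m i lam = none) ∧
    (0 < phiList i (betaList m lam 0 N) → ∃ mu, fOp e m i lam = some mu ∧ mu.colLen 0 ≤ N ∧
      betaList m mu 0 N = moveBeads i 1 (betaList m lam 0 N)) := by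
  obtain ⟨p, q, h, hlen, hlast⟩ :=
    raReduce_beadLetters_shape (m := m) (i := i) (lam := lam) he N 0
  have hnormal : normalAddable e m i lam = p := by
    rw [normalAddable, raReduce_word he hN hi, h, List.filterMap_append, List.filterMap_map,
      List.filterMap_map]
    simp
  constructor
  · intro h0
    rw [h0, List.length_eq_zero_iff] at hlen
    rw [fOp, hnormal, hlen]
    rfl
  · intro hpos
    have hne : p ≠ [] := by
      rintro rfl
      simp at hlen
      omega
    obtain ⟨r, -, hx, hmove⟩ := hlast (p.getLast hne) (List.getLast?_eq_some_getLast hne)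
    have hf : fOp e m i lam = some (addNode lam (p.getLast hne)) := by
      rw [fOp, hnormal, List.getLast?_eq_some_getLast hne]
      rfl
    obtain ⟨x, hadd, hcells⟩ := fOp_spec hf
    -- the node added is the one recorded by the last letter
    have hxl : x = p.getLast hne := by
      by_contra hne'
      have h1 : x ∈ (addNode lam (p.getLast hne)).cells := by
        rw [hcells]
        exact Finset.mem_insert_self _ _
      rw [addNode] at h1
      split_ifs at h1 with h2
      · rcases Finset.mem_insert.1 h1 with h3 | h3
        · exact hne' h3
        · exact hadd.1 h3
      · exact hadd.1 h1
    rw [hxl] at hcells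
    rw [hx] at hcells hf
    refine ⟨_, hf, ?_, ?_⟩
    · refine colLen_le_of_mem_betaSet (m := m) fun y hy => ?_
      obtain ⟨k, hk⟩ := mem_betaSet_of_le hN hy
      have hrN : r ≠ k := by
        rintro rfl
        have h3 : IsAddable e m i lam (r, lam.rowLen r) := by
          rw [← hx, ← hxl]
          exact hadd
        have h4 := rowLetters_eq_nil hN hi (k := r) (by
          by_contra hlt
          have : m - r ≤ betaNum m lam r := by
            simp only [betaNum]
            omega
          omega)
        rw [rowLetters, if_pos h3] at h4
        simp at h4
      exact ⟨k, by rw [betaNum_of_insert hcells, if_neg hrN.symm, add_zero, hk]⟩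
    · rw [hmove, betaList]
      exact List.map_congr_left fun l _ => betaNum_of_insert hcells l

theorem fPow_succ (t : ℕ) :
    fPow e m i (t + 1) lam = (fPow e m i t lam).bind (fOp e m i) := by
  rw [fPow, Function.iterate_succ_apply']
  rfl

/-- The powers of `f̃_i` in terms of the list of beta numbers. -/
theorem fPow_eq_some (he : 2 ≤ e) {N : ℕ} (hN : lam.colLen 0 ≤ N)
    (hi : ((m - N : ℤ) : ZMod e) ≠ i) (t : ℕ) (ht : t ≤ phiList i (betaList m lam 0 N)) :
    ∃ mu, fPow e m i t lam = some mu ∧ mu.colLen 0 ≤ N ∧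
      betaList m mu 0 N = moveBeads i t (betaList m lam 0 N) := by
  induction t with
  | zero => exact ⟨lam, rfl, hN, (moveBeads_zero _).symm⟩
  | succ t ih =>
    obtain ⟨mu, h1, h2, h3⟩ := ih (by omega)
    have hphi := phiList_moveBeads he _ t (show t ≤ phiList i (betaList m lam 0 N) by omega)
    rw [← h3] at hphi
    obtain ⟨nu, h4, h5, h6⟩ := (fOp_cases he h2 hi).2 (by omega)
    refine ⟨nu, ?_, h5, ?_⟩
    · rw [fPow_succ, h1]
      exact h4
    · rw [h6, h3, moveBeads_moveBeads he _ _ _ (by omega), add_comm]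

theorem phi_eq_phiList (he : 2 ≤ e) {N : ℕ} (hN : lam.colLen 0 ≤ N)
    (hi : ((m - N : ℤ) : ZMod e) ≠ i) :
    phi e m i lam = phiList i (betaList m lam 0 N) := by
  refine (phi_isGreatest he m i lam).unique ⟨?_, ?_⟩
  · obtain ⟨mu, h, -⟩ := fPow_eq_some he hN hi _ le_rfl
    rw [Set.mem_ofPred_eq, h]
    exact Option.some_ne_none mu
  · intro k hk
    by_contra hlt
    push Not at hlt
    refine hk ?_
    induction k, (show phiList i (betaList m lam 0 N) + 1 ≤ k from hlt) using
      Nat.le_induction with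
    | base =>
      obtain ⟨mu, h1, h2, h3⟩ := fPow_eq_some he hN hi _ le_rfl
      rw [fPow_succ, h1]
      refine (fOp_cases he h2 hi).1 ?_
      rw [h3, phiList_moveBeads he _ _ le_rfl, Nat.sub_self]
    | succ k hk' ih =>
      rw [fPow_succ]
      by_cases h0 : fPow e m i k lam = none
      · rw [h0]
        rfl
      · exact absurd (ih h0 hk') h0

end words

/-! ### Weights and reflections of cores -/

section weight

variable {e : ℕ} {m : ℤ} {i : ZMod e} {lam : YoungDiagram}

/-- The pairing of the weight with `h_i` counts the beads of residue `i` and, with the opposite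
sign, those of residue `i + 1`: along each row the entries of the Cartan matrix telescope. -/
theorem wtPairing_eq_sum {N : ℕ} (hN : lam.colLen 0 ≤ N) (hi : ((m - N : ℤ) : ZMod e) ≠ i) :
    wtPairing e m i lam = ((betaList m lam 0 N).map fun x : ℤ =>
      (if (x : ZMod e) = i then (1 : ℤ) else 0) - if (x : ZMod e) = i + 1 then 1 else 0).sum := by
  set g : ZMod e → ℤ := fun c => (if c = i then 1 else 0) - if c = i + 1 then 1 else 0 with hg
  have hcartan : ∀ c : ZMod e, cartan e i c = g c - g (c + 1) := by
    intro c
    have h1 : c = i - 1 ↔ c + 1 = i := eq_sub_iff_add_eq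
    simp only [cartan, hg, h1, add_left_inj]
    split_ifs <;> ring
  have hrow : ∀ k : ℕ, ∑ b ∈ Finset.range (lam.rowLen k), cartan e i (residue e m (k, b)) =
      g ((m - k : ℤ) : ZMod e) - g ((betaNum m lam k : ℤ) : ZMod e) := by
    intro k
    have h1 := Finset.sum_range_sub' (fun b : ℕ => g ((m - k + b : ℤ) : ZMod e)) (lam.rowLen k)
    have h2 : betaNum m lam k = m - k + (lam.rowLen k : ℤ) := by
      rw [betaNum]
      ring
    rw [h2]
    simp only [Nat.cast_zero, add_zero] at h1
    rw [← h1]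
    refine Finset.sum_congr rfl fun b _ => ?_
    rw [hcartan, residue]
    push_cast
    rw [add_assoc]
  have hcells : ∑ x ∈ lam.cells, cartan e i (residue e m x) =
      ∑ k ∈ Finset.range N, ∑ b ∈ Finset.range (lam.rowLen k),
        cartan e i (residue e m (k, b)) := by
    refine Finset.sum_finset_product _ _ _ ?_
    rintro ⟨a, b⟩
    rw [YoungDiagram.mem_cells, YoungDiagram.mem_iff_lt_rowLen, Finset.mem_range,
      Finset.mem_range]
    refine ⟨fun h => ⟨?_, h⟩, fun h => h.2⟩
    by_contra hc
    have := rowLen_eq_zero (lam := lam) (show lam.colLen 0 ≤ a by omega)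
    omega
  have htop : ∑ k ∈ Finset.range N, g ((m - k : ℤ) : ZMod e) =
      if (m : ZMod e) = i then 1 else 0 := by
    have h1 := Finset.sum_range_sub'
      (fun k : ℕ => if ((m - k : ℤ) : ZMod e) = i then (1 : ℤ) else 0) N
    simp only [if_neg hi, Nat.cast_zero, sub_zero] at h1
    rw [← h1]
    refine Finset.sum_congr rfl fun k _ => ?_
    have h2 : ((m - k : ℤ) : ZMod e) = i + 1 ↔ ((m - (k + 1 : ℕ) : ℤ) : ZMod e) = i := by
      rw [← sub_eq_iff_eq_add]
      push_cast
      rw [sub_sub]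
    simp only [hg, h2]
  have hlist : ((betaList m lam 0 N).map fun x : ℤ => g (x : ZMod e)).sum =
      ∑ k ∈ Finset.range N, g ((betaNum m lam k : ℤ) : ZMod e) := by
    rw [betaList, List.map_map, ← List.range_eq_range']
    rfl
  rw [hlist, wtPairing, hcells, Finset.sum_congr rfl fun k _ => hrow k, Finset.sum_sub_distrib,
    htop]
  ring

theorem sortRunners_Iio (he : 2 ≤ e) {a : ℤ} (ha : ((a - 1 : ℤ) : ZMod e) ≠ i) :
    sortRunners e i (Set.Iio a) = Set.Iio a := by
  ext x
  by_cases h1 : (x : ZMod e) = i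
  · rw [mem_sortRunners_left he h1, Set.mem_Iio, Set.mem_Iio]
    have : x ≠ a - 1 := by
      rintro rfl
      exact ha h1
    omega
  · by_cases h2 : (x : ZMod e) = i + 1
    · rw [mem_sortRunners_right he h2, Set.mem_Iio, Set.mem_Iio]
      have : x ≠ a := by
        rintro rfl
        exact ha (cast_sub_one_eq h2)
      omega
    · exact mem_sortRunners_other h1 h2

theorem betaSet_base_eq_insertList (he : 2 ≤ e) {N : ℕ} (hN : lam.colLen 0 ≤ N) :
    betaSet m (base e m lam) =
      insertList e (Set.Iio (m - N + 1)) (betaList m lam 0 N) ∧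
    (base e m lam).colLen 0 ≤ N := by
  have hlt : ∀ x ∈ betaSet m lam, x < m - N + 1 + (lam.rowLen 0 + N : ℕ) := by
    rintro x ⟨k, rfl⟩
    have := (betaNum_strictAnti m lam).antitone (Nat.zero_le k)
    simp only [betaNum] at this ⊢
    push_cast at this ⊢
    omega
  obtain ⟨h1, h2⟩ := betaSet_base (m := m) (lam := lam) (e := e) (by omega)
    (fun x hx => mem_betaSet_of_le hN (by omega)) hlt
  refine ⟨?_, colLen_le_of_mem_betaSet (m := m) fun x hx => h2 x (by omega)⟩
  rw [h1, insertList_eq_insertBeads (m - N + 1) (lam.rowLen 0 + N) _ _ (pairwise_betaList 0 N)]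
  · refine insertBeads_congr fun x hx _ => ?_
    rw [Set.mem_ofPred_eq, mem_betaList_iff hN]
    exact ⟨fun h => ⟨h, by omega⟩, fun h => h.1⟩
  · intro x hx
    rw [mem_betaList_iff hN] at hx
    exact ⟨by omega, hlt x hx.1⟩

/-- On an `e`-core with an addable `i`-node, `s_i` sorts the runners `i` and `i + 1`. -/
theorem sRefl_of_core (he : 2 ≤ e) {N : ℕ} (hN : lam.colLen 0 ≤ N)
    (hi : ((m - N : ℤ) : ZMod e) ≠ i) (hU : U e (betaSet m lam) = ∅)
    (hadd : ∃ x, IsAddable e m i lam x) :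
    ∃ mu, sRefl e m i lam = some mu ∧ betaSet m mu = sortRunners e i (betaSet m lam) := by
  obtain ⟨y, hy, hyJ, hyJ1⟩ := exists_isAddable_iff.1 hadd
  have hclosed : SlideClosed e (betaSet m lam) := by
    intro x hx
    by_contra hc
    exact Set.eq_empty_iff_forall_notMem.1 hU x ⟨hx, hc⟩
  have hleft : ∀ x ∈ betaList m lam 0 N, (x : ZMod e) = i + 1 → x - 1 ∈ betaList m lam 0 N := by
    intro x hx hxi
    rw [mem_betaList_iff hN] at hx ⊢
    have hyi := cast_add_one_eq hy
    constructor
    · refine hclosed.mem_of_le hyJ ((cast_sub_one_eq hxi).trans hy.symm) ?_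
      by_contra hc
      exact hyJ1 (hclosed.mem_of_le hx.1 (hyi.trans hxi.symm) (by omega))
    · have : x - 1 ≠ m - N := fun h => hi (h ▸ cast_sub_one_eq hxi)
      omega
  obtain ⟨hsum, hset⟩ := phiList_of_noRemovable he _ (pairwise_betaList 0 N) hleft
  have hwt := (wtPairing_eq_sum hN hi).trans hsum.symm
  obtain ⟨mu, hmu, hmuN, hlist⟩ := fPow_eq_some he hN hi _ le_rfl
  refine ⟨mu, ?_, ?_⟩
  · rw [sRefl, hwt, if_pos (Int.natCast_nonneg _), Int.toNat_natCast]
    exact hmu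
  · have hmem : ∀ x : ℤ, m - N < x → (x ∈ betaSet m lam ↔ x ∈ betaList m lam 0 N) := by
      intro x hx
      rw [mem_betaList_iff hN]
      simp [hx]
    ext x
    by_cases hx : m - N < x
    · have h1 : x ∈ betaSet m mu ↔ x ∈ sortRunners e i {x | x ∈ betaList m lam 0 N} := by
        rw [← hset, ← hlist, Set.mem_ofPred_eq, mem_betaList_iff hmuN]
        simp [hx]
      rw [h1]
      by_cases hx1 : (x : ZMod e) = i
      · rw [mem_sortRunners_left he hx1, mem_sortRunners_left he hx1, Set.mem_ofPred_eq,
          Set.mem_ofPred_eq, hmem x hx, hmem (x + 1) (by omega)]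
      · by_cases hx2 : (x : ZMod e) = i + 1
        · have : x - 1 ≠ m - N := fun h => hi (h ▸ cast_sub_one_eq hx2)
          rw [mem_sortRunners_right he hx2, mem_sortRunners_right he hx2, Set.mem_ofPred_eq,
            Set.mem_ofPred_eq, hmem x hx, hmem (x - 1) (by omega)]
        · rw [mem_sortRunners_other hx1 hx2, mem_sortRunners_other hx1 hx2, hmem x hx,
            Set.mem_ofPred_eq]
    · refine ⟨fun _ => ?_, fun _ => mem_betaSet_of_le hmuN (by omega)⟩
      have hxJ : x ∈ betaSet m lam := mem_betaSet_of_le hN (by omega)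
      by_cases hx1 : (x : ZMod e) = i
      · have : x ≠ m - N := fun h => hi (h ▸ hx1)
        exact (mem_sortRunners_left he hx1).2 ⟨hxJ, mem_betaSet_of_le hN (by omega)⟩
      · by_cases hx2 : (x : ZMod e) = i + 1
        · exact (mem_sortRunners_right he hx2).2 (Or.inl hxJ)
        · exact (mem_sortRunners_other hx1 hx2).2 hxJ

theorem sortRunners_of_not_isAddable (he : 2 ≤ e) (h : ¬ ∃ x, IsAddable e m i lam x) :
    sortRunners e i (betaSet m lam) = betaSet m lam := by
  have key : ∀ y : ℤ, (y : ZMod e) = i → y ∈ betaSet m lam → y + 1 ∈ betaSet m lam := by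
    intro y hy hmem
    by_contra hc
    exact h (exists_isAddable_iff.2 ⟨y, hy, hmem, hc⟩)
  ext x
  by_cases h1 : (x : ZMod e) = i
  · rw [mem_sortRunners_left he h1]
    exact ⟨fun h => h.1, fun h => ⟨h, key x h1 h⟩⟩
  · by_cases h2 : (x : ZMod e) = i + 1
    · rw [mem_sortRunners_right he h2]
      refine ⟨?_, Or.inl⟩
      rintro (h | h)
      · exact h
      · simpa using key _ (cast_sub_one_eq h2) h
    · exact mem_sortRunners_other h1 h2

end weight

end KashiwaraBase

open KashiwaraBase in
theorem mainTheorem4 (e : ℕ) (he : 2 ≤ e) (m : ℤ) (i : ZMod e) (lam : YoungDiagram)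
    (hlam : KashiwaraBase.IsRestricted e lam) :
    (∃ mu : YoungDiagram, KashiwaraBase.fMax e m i lam = some mu ∧
      ((∃ x, KashiwaraBase.IsAddable e m i (KashiwaraBase.base e m lam) x) →
        KashiwaraBase.sRefl e m i (KashiwaraBase.base e m lam) =
          some (KashiwaraBase.base e m mu)) ∧
      ((¬ ∃ x, KashiwaraBase.IsAddable e m i (KashiwaraBase.base e m lam) x) →
        KashiwaraBase.base e m mu = KashiwaraBase.base e m lam)) ∧
    (∀ t : ℕ, t < KashiwaraBase.phi e m i lam →
      ∃ nu : YoungDiagram, KashiwaraBase.fPow e m i t lam = some nu ∧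
        KashiwaraBase.base e m nu = KashiwaraBase.base e m lam) := by
  -- enough rows, such that no bead of residue `i` is the greatest one below them
  obtain ⟨N, hN, hi⟩ : ∃ N : ℕ, lam.colLen 0 ≤ N ∧ ((m - N : ℤ) : ZMod e) ≠ i := by
    by_cases h : ((m - (lam.colLen 0 : ℕ) : ℤ) : ZMod e) = i
    · refine ⟨lam.colLen 0 + 1, Nat.le_succ _, fun h2 => ?_⟩
      have h3 := cast_add_one_eq h2
      rw [show m - ((lam.colLen 0 + 1 : ℕ) : ℤ) + 1 = m - (lam.colLen 0 : ℕ) by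
        push_cast; ring, h] at h3
      exact zmod_ne_add_one he i h3
    · exact ⟨_, le_rfl, h⟩
  have hC : sortRunners e i (Set.Iio (m - N + 1)) = Set.Iio (m - N + 1) :=
    sortRunners_Iio he (by simpa using hi)
  obtain ⟨hbase, hbaseN⟩ := betaSet_base_eq_insertList (m := m) he hN
  have hphi := phi_eq_phiList he hN hi
  constructor
  · obtain ⟨mu, hmu, hmuN, hlist⟩ := fPow_eq_some he hN hi _ le_rfl
    have hmubase := (betaSet_base_eq_insertList (m := m) he hmuN).1
    rw [hlist, insertList_moveBeads he hC _ _ le_rfl, if_neg (lt_irrefl _), ← hbase] at hmubase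
    refine ⟨mu, by rw [fMax, hphi]; exact hmu, fun hadd => ?_, fun hadd => ?_⟩
    · obtain ⟨nu, h1, h2⟩ := sRefl_of_core he hbaseN hi (U_base e m lam) hadd
      rw [h1, betaSet_injective m (h2.trans hmubase.symm)]
    · exact betaSet_injective m (hmubase.trans (sortRunners_of_not_isAddable he hadd))
  · intro t ht
    rw [hphi] at ht
    obtain ⟨nu, hnu, hnuN, hlist⟩ := fPow_eq_some he hN hi t ht.le
    refine ⟨nu, hnu, betaSet_injective m ?_⟩
    rw [(betaSet_base_eq_insertList (m := m) he hnuN).1, hlist,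
      insertList_moveBeads he hC _ _ ht.le, if_pos ht, hbase]
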